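/- Let $G$ be a Lie group, $H\subset G$ a closed subgroup, and let the homogeneous manifold $G/H$ carry a reductive decomposition $\mathfrak g=\mathfrak h+\mathfrak m$ (a direct sum with $\mathrm{Ad}(H)\mathfrak m\subset\mathfrak m$). Identify $T_{eH}(G/H)$ with $\mathfrak m$, and let $[\cdot,\cdot]_{\mathfrak m}$ denote the bracket followed by the projection to $\mathfrak m$ along $\mathfrak h$. Let $\alpha(\cdot,\cdot)$ be an $\mathrm{Ad}(H)$-invariant inner product on $\mathfrak m$, write $\alpha(y)=\sqrt{\alpha(y,y)}$, and let $\beta=\alpha(X,\cdot)$, where $X\in\mathfrak m\setminus\{0\}$ is $\mathrm{Ad}(H)$-invariant. Let $\phi$ be a positive smooth function on an interval $(-b_0,b_0)$ with $b_0>\sqrt{\alpha(X,X)}$. Suppose that $F=\alpha\,\phi(\beta/\alpha)$ on $\mathfrak m$ is the restriction of a $G$-invariant Finsler metric on $G/H$ (also denoted $F$) which is not Riemannian and is a Douglas metric, i.e. in local coordinates its geodesic spray coefficients have the form $G^i=\tfrac12\Gamma^i_{jk}(x)y^jy^k+P(x,y)y^i$. Suppose also that $\alpha$ is cyclic, i.e.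 $$\alpha([x,y]_{\mathfrak m},z)+\alpha([y,z]_{\mathfrak m},x)+\alpha([z,x]_{\mathfrak m},y)=0\quad\text{for all }x,y,z\in\mathfrak m.$$ Then $(G/H,F)$ is cyclic with respect to $\mathfrak g=\mathfrak h+\mathfrak m$, i.e. $$\langle[x,y]_{\mathfrak m},z\rangle_y+\langle[y,z]_{\mathfrak m},x\rangle_y+\langle[z,x]_{\mathfrak m},y\rangle_y=0\quad\text{for all }x,z\in\mathfrak m,\ y\in\mathfrak m\setminus\{0\},$$ where $\langle u,v\rangle_y=\tfrac12\tfrac{\partial^2}{\partial s\,\partial t}\big|_{s=t=0}F^2(y+su+tv)$, if and only if $$\alpha([y,u]_{\mathfrak m},y)\big[\alpha(y,y)\alpha(X,v)-\alpha(X,y)\alpha(v,y)\big]=\alpha([y,v]_{\mathfrak m},y)\big[\alpha(y,y)\alpha(X,u)-\alpha(X,y)\alpha(u,y)\big]$$ for all $u,v,y\in\mathfrak m$. -/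

import Mathlib

open scoped Manifold ContDiff

noncomputable section

namespace CyclicFinsler

/-! ### Minkowski norms and Finsler metrics -/

/-- The fundamental tensor `⟨u, v⟩_y = ½ ∂²/∂s∂t |_{s=t=0} F²(y + s u + t v)` of a function `F`
on a real vector space. -/
def fundamentalTensor {V : Type*} [AddCommGroup V] [Module ℝ V] (F : V → ℝ) (y u v : V) : ℝ :=
  (1 / 2) * deriv (fun s : ℝ => deriv (fun t : ℝ => F (y + s • u + t • v) ^ 2) 0) 0

section Manifold

variable {E : Type*} [NormedAddCommGroup E] [NormedSpace ℝ E]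
  {M : Type*} [TopologicalSpace M] [ChartedSpace E M]

/-- `F` is a Finsler metric on the manifold `M` (modelled on `E`): a function on the tangent bundle
that is smooth off the zero section and restricts to a Minkowski norm on each tangent space, i.e.
it is positive on nonzero vectors, positively homogeneous of degree one, and has positive definite
fundamental tensors. -/
structure IsFinslerMetric [IsManifold 𝓘(ℝ, E) ∞ M]
    (F : (p : M) → TangentSpace 𝓘(ℝ, E) p → ℝ) : Prop where
  smooth : ContMDiffOn 𝓘(ℝ, E).tangent 𝓘(ℝ, ℝ) ∞
    (fun w : TangentBundle 𝓘(ℝ, E) M => F w.proj w.snd)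
    {w : TangentBundle 𝓘(ℝ, E) M | w.snd ≠ 0}
  pos : ∀ (p : M) (y : TangentSpace 𝓘(ℝ, E) p), y ≠ 0 → 0 < F p y
  homogeneous : ∀ (p : M) (t : ℝ) (y : TangentSpace 𝓘(ℝ, E) p), 0 ≤ t → F p (t • y) = t * F p y
  posDef : ∀ (p : M) (y u : TangentSpace 𝓘(ℝ, E) p), y ≠ 0 → u ≠ 0 →
    0 < fundamentalTensor (F p) y u u

/-- `F` is Riemannian: on each tangent space its square is a quadratic form. (For a Finsler metric
the symmetric bilinear form is then the fundamental tensor, so it is positive definite and varies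
smoothly with the point.) -/
def IsRiemannian (F : (p : M) → TangentSpace 𝓘(ℝ, E) p → ℝ) : Prop :=
  ∀ p : M, ∃ B : TangentSpace 𝓘(ℝ, E) p →ₗ[ℝ] TangentSpace 𝓘(ℝ, E) p →ₗ[ℝ] ℝ,
    (∀ u v, B u v = B v u) ∧ ∀ v, F p v ^ 2 = B v v

/-- The coordinate expression `(x, y) ↦ F(x, y)` of `F` in a chart `e`. -/
def coordExpr (F : (p : M) → TangentSpace 𝓘(ℝ, E) p → ℝ) (e : OpenPartialHomeomorph M E)
    (x y : E) : ℝ :=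
  F (e.symm x) (mfderiv 𝓘(ℝ, E) 𝓘(ℝ, E) e.symm x y)

/-- `G` is the vector of geodesic spray coefficients at `(x, y)` of the coordinate expression `F`
of a Finsler metric:
`G^i = ¼ g^{il} ([F²]_{x^k y^l} y^k - [F²]_{x^l})`, where `g` is the fundamental tensor at `y`.
It is written here without inverting `g`, as `g(G, v) = ¼ ([F²]_{x^k y^l} y^k v^l - [F²]_{x^l} v^l)`
for all `v`. -/
def IsSprayCoefficient (F : E → E → ℝ) (x y G : E) : Prop :=
  ∀ v : E, fundamentalTensor (F x) y G v =
    (1 / 4) * (deriv (fun s : ℝ => deriv (fun t : ℝ => F (x + t • y) (y + s • v) ^ 2) 0) 0 -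
      deriv (fun t : ℝ => F (x + t • v) y ^ 2) 0)

/-- `F` is a Douglas metric: in every local coordinate system its geodesic spray coefficients
have the form `G^i = ½ Γ^i_{jk}(x) y^j y^k + P(x, y) y^i`. -/
def IsDouglas [IsManifold 𝓘(ℝ, E) ∞ M] (F : (p : M) → TangentSpace 𝓘(ℝ, E) p → ℝ) : Prop :=
  ∀ e ∈ IsManifold.maximalAtlas 𝓘(ℝ, E) ∞ M, ∀ x ∈ e.target,
    ∃ (Γ : E →ₗ[ℝ] E →ₗ[ℝ] E) (P : E → ℝ), (∀ u v, Γ u v = Γ v u) ∧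
      ∀ y : E, y ≠ 0 →
        IsSprayCoefficient (coordExpr F e) x y ((1 / 2 : ℝ) • Γ y y + P y • y)

end Manifold

/-! ### Homogeneous manifolds and reductive decompositions -/

section Homogeneous

variable {E : Type*} [NormedAddCommGroup E] [NormedSpace ℝ E]
  {G : Type*} [TopologicalSpace G] [Group G] [ChartedSpace E G]
  {E' : Type*} [NormedAddCommGroup E'] [NormedSpace ℝ E']

/-- The adjoint action of `g` on the Lie algebra: the derivative at `1` of `x ↦ g x g⁻¹`. -/
def Ad (g : G) (x : GroupLieAlgebra 𝓘(ℝ, E) G) : GroupLieAlgebra 𝓘(ℝ, E) G :=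
  mfderiv 𝓘(ℝ, E) 𝓘(ℝ, E) (fun a : G => g * a * g⁻¹) 1 x

/-- The differential at the identity of the projection `G → G/H`, from the Lie algebra of `G` to
the tangent space of `G/H` at the origin `o = eH`. -/
def projDeriv (H : Subgroup G) [ChartedSpace E' (G ⧸ H)] :
    GroupLieAlgebra 𝓘(ℝ, E) G →ₗ[ℝ] TangentSpace 𝓘(ℝ, E') ((1 : G) : G ⧸ H) :=
  (mfderiv 𝓘(ℝ, E) 𝓘(ℝ, E') (fun a : G => (a : G ⧸ H)) 1).toLinearMap

/-- The Lie algebra `𝔥` of `H`. As `G → G/H` is a submersion whose fibre over the origin is `H`,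
the tangent space of `H` at the identity is the kernel of the differential of the projection. -/
def isotropyAlgebra (E' : Type*) [NormedAddCommGroup E'] [NormedSpace ℝ E'] (H : Subgroup G)
    [ChartedSpace E' (G ⧸ H)] : Submodule ℝ (GroupLieAlgebra 𝓘(ℝ, E) G) :=
  LinearMap.ker (projDeriv (E' := E') H)

/-- A reductive decomposition `𝔤 = 𝔥 + 𝔪` (direct sum) of the homogeneous manifold `G/H`:
a complement `𝔪` of `𝔥` which is `Ad(H)`-invariant. -/
structure ReductiveDecomposition (E : Type*) [NormedAddCommGroup E] [NormedSpace ℝ E]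
    {G : Type*} [TopologicalSpace G] [Group G] [ChartedSpace E G]
    (E' : Type*) [NormedAddCommGroup E'] [NormedSpace ℝ E'] (H : Subgroup G)
    [ChartedSpace E' (G ⧸ H)] where
  m : Submodule ℝ (GroupLieAlgebra 𝓘(ℝ, E) G)
  isCompl : IsCompl m (isotropyAlgebra E' H)
  ad_mem : ∀ h ∈ H, ∀ x ∈ m, Ad (E := E) h x ∈ m

variable {H : Subgroup G} [ChartedSpace E' (G ⧸ H)]

namespace ReductiveDecomposition

/-- The bracket `[x, y]_𝔪` of `x, y ∈ 𝔪` followed by the projection to `𝔪` along `𝔥`. -/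
def bracket (D : ReductiveDecomposition E E' H) (x y : D.m) : D.m :=
  D.m.projectionOnto (isotropyAlgebra E' H) D.isCompl
    ⁅(x : GroupLieAlgebra 𝓘(ℝ, E) G), (y : GroupLieAlgebra 𝓘(ℝ, E) G)⁆

/-- The `Ad(H)`-action on `𝔪`. -/
def adOn (D : ReductiveDecomposition E E' H) (h : H) (x : D.m) : D.m :=
  ⟨Ad (E := E) (h : G) (x : GroupLieAlgebra 𝓘(ℝ, E) G), D.ad_mem h h.2 x x.2⟩

/-- `α` is an `Ad(H)`-invariant inner product on `𝔪`. -/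
structure IsInvariantInner (D : ReductiveDecomposition E E' H)
    (α : D.m →ₗ[ℝ] D.m →ₗ[ℝ] ℝ) : Prop where
  symm : ∀ u v, α u v = α v u
  posDef : ∀ u, u ≠ 0 → 0 < α u u
  invariant : ∀ (h : H) (u v : D.m), α (D.adOn h u) (D.adOn h v) = α u v

/-- The homogeneous Riemannian metric on `G/H` determined by `α` is cyclic with respect to the
reductive decomposition. -/
def IsCyclicInner (D : ReductiveDecomposition E E' H) (α : D.m →ₗ[ℝ] D.m →ₗ[ℝ] ℝ) : Prop :=
  ∀ x y z : D.m, α (D.bracket x y) z + α (D.bracket y z) x + α (D.bracket z x) y = 0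

/-- The restriction of `F` to `𝔪`, identified with the tangent space of `G/H` at the origin
through the differential of the projection. -/
def normOn (D : ReductiveDecomposition E E' H)
    (F : (p : G ⧸ H) → TangentSpace 𝓘(ℝ, E') p → ℝ) (x : D.m) : ℝ :=
  F ((1 : G) : G ⧸ H) (projDeriv (E' := E') H (x : GroupLieAlgebra 𝓘(ℝ, E) G))

/-- The homogeneous Finsler manifold `(G/H, F)` is cyclic with respect to the reductive
decomposition. -/
def IsCyclic (D : ReductiveDecomposition E E' H)
    (F : (p : G ⧸ H) → TangentSpace 𝓘(ℝ, E') p → ℝ) : Prop :=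
  ∀ x y z : D.m, y ≠ 0 →
    fundamentalTensor (D.normOn F) y (D.bracket x y) z +
      fundamentalTensor (D.normOn F) y (D.bracket y z) x +
      fundamentalTensor (D.normOn F) y (D.bracket z x) y = 0

end ReductiveDecomposition

/-- `F` is invariant under the action of `G` on `G/H`. -/
def IsInvariantMetric (F : (p : G ⧸ H) → TangentSpace 𝓘(ℝ, E') p → ℝ) : Prop :=
  ∀ (g : G) (p : G ⧸ H) (v : TangentSpace 𝓘(ℝ, E') p),
    F (g • p) (mfderiv 𝓘(ℝ, E') 𝓘(ℝ, E') (fun q : G ⧸ H => g • q) p v) = F p v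

end Homogeneous

end CyclicFinsler

end

/-! Put ψ = φ² and s = β/α, so that F² = α² ψ(s) and the fundamental tensor is an explicit
expression in ψ, ψ', ψ'' (`fundamentalTensor_eq_secondDeriv`). Suppose α(X, [u, v]_𝔪) = 0 for all u,
v, i.e. the invariant form β is closed. Then cyclicity of α kills every term in the cyclic sum of F
except a multiple of (ψ' - s ψ'')/α³ times the difference of the two sides of the algebraic
condition (`cyclicSum_eq_of_closed`). The factor ψ' - s ψ'' is nonzero for some |s| < |X|; otherwise
ψ = A + C s² and F² = A α² + C β² is Riemannian. The difference is polynomial in y, so it vanishes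
everywhere once it vanishes near a point with such a slope s (`cyclicSum_iff_of_closed`).

Closedness of β comes from the Douglas condition when dim G/H > 2 (`closed_of_spray`). A lift of a
chart of G/H to G pulls back the Maurer-Cartan form. Its 𝔪-part is a coframe B in which F is the
fixed norm on 𝔪, and the structure equation says that dB is minus the 𝔪-bracket at the base point
(`exists_chart_coframe`). Testing the spray equation against v orthogonal to y and X removes the
term P(x, y) y and leaves α ψ'(s) dβ(y, v) = (2ψ - s ψ') κ(y, v) with κ quadratic in y. Restricted
to α-circles through X, this forces dβ = 0 or ψ' = k s (2ψ - s ψ') for a constant k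
(`closed_or_profile_eq`). The latter integrates to ψ = A (1 + k s²), which is again Riemannian.

In dimension at most two the vectors x, y, z are dependent, and both conditions hold identically. -/

noncomputable section

namespace CyclicFinsler

/-! ### The Lie bracket of `G` in the chart at the identity -/

section LieGroup

open Filter Topology

variable {E : Type*} [NormedAddCommGroup E] [NormedSpace ℝ E]
  {G : Type*} [TopologicalSpace G] [Group G] [ChartedSpace E G]
  {E' : Type*} [NormedAddCommGroup E'] [NormedSpace ℝ E']

/-- The identification of the Lie algebra of `G` with the model space. -/
def lieModel (E : Type*) [NormedAddCommGroup E] [NormedSpace ℝ E]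
    (G : Type*) [TopologicalSpace G] [Group G] [ChartedSpace E G] :
    GroupLieAlgebra 𝓘(ℝ, E) G ≃ₗ[ℝ] E :=
  LinearEquiv.refl ℝ E

/-- The multiplication of `G` read in the preferred chart at the identity. -/
def chartMul (E : Type*) [NormedAddCommGroup E] [NormedSpace ℝ E]
    (G : Type*) [TopologicalSpace G] [Group G] [ChartedSpace E G] (ξ ζ : E) : E :=
  extChartAt 𝓘(ℝ, E) (1 : G)
    ((extChartAt 𝓘(ℝ, E) (1 : G)).symm ξ * (extChartAt 𝓘(ℝ, E) (1 : G)).symm ζ)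

/-- The coordinates of the identity in the preferred chart at the identity. -/
def chartOne (E : Type*) [NormedAddCommGroup E] [NormedSpace ℝ E]
    (G : Type*) [TopologicalSpace G] [Group G] [ChartedSpace E G] : E :=
  extChartAt 𝓘(ℝ, E) (1 : G) (1 : G)

/-- The left-invariant frame read in the preferred chart at the identity. -/
def leftFrame (E : Type*) [NormedAddCommGroup E] [NormedSpace ℝ E]
    (G : Type*) [TopologicalSpace G] [Group G] [ChartedSpace E G] (ξ : E) : E →L[ℝ] E :=
  fderiv ℝ (chartMul E G ξ) (chartOne E G)

theorem extChartAt_symm_chartOne :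
    (extChartAt 𝓘(ℝ, E) (1 : G)).symm (chartOne E G) = 1 :=
  extChartAt_to_inv (I := 𝓘(ℝ, E)) (1 : G)

theorem chartOne_mem_target : chartOne E G ∈ (extChartAt 𝓘(ℝ, E) (1 : G)).target :=
  mem_extChartAt_target (I := 𝓘(ℝ, E)) (1 : G)

theorem target_mem_nhds_chartOne :
    (extChartAt 𝓘(ℝ, E) (1 : G)).target ∈ 𝓝 (chartOne E G) :=
  extChartAt_target_mem_nhds (I := 𝓘(ℝ, E)) (1 : G)

theorem leftFrame_chartOne : leftFrame E G (chartOne E G) = ContinuousLinearMap.id ℝ E := by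
  have : chartMul E G (chartOne E G) =ᶠ[𝓝 (chartOne E G)] id := by
    filter_upwards [target_mem_nhds_chartOne (E := E) (G := G)] with ζ hζ
    simp only [chartMul, extChartAt_symm_chartOne, one_mul, id]
    exact (extChartAt 𝓘(ℝ, E) (1 : G)).right_inv hζ
  rw [leftFrame, this.fderiv_eq, fderiv_id]

variable [LieGroup 𝓘(ℝ, E) ∞ G]

theorem contMDiffAt_extChartAt_symm_of_mem_target {ξ : E}
    (hξ : ξ ∈ (extChartAt 𝓘(ℝ, E) (1 : G)).target) :
    ContMDiffAt 𝓘(ℝ, E) 𝓘(ℝ, E) ∞ (extChartAt 𝓘(ℝ, E) (1 : G)).symm ξ := by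
  exact (contMDiffOn_extChartAt_symm (I := 𝓘(ℝ, E)) (n := ∞) (1 : G)).contMDiffAt
    ((isOpen_extChartAt_target (I := 𝓘(ℝ, E)) (1 : G)).mem_nhds hξ)

theorem contDiffAt_chartMul :
    ContDiffAt ℝ ∞ (Function.uncurry (chartMul E G)) (chartOne E G, chartOne E G) := by
  rw [← contMDiffAt_iff_contDiffAt]
  have h := contMDiffAt_extChartAt_symm_of_mem_target (G := G) (chartOne_mem_target (E := E))
  have h1 : ContMDiffAt 𝓘(ℝ, E × E) 𝓘(ℝ, E) ∞
      (fun p : E × E => (extChartAt 𝓘(ℝ, E) (1 : G)).symm p.1) (chartOne E G, chartOne E G) :=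
    ContMDiffAt.comp (f := Prod.fst) (x := (chartOne E G, chartOne E G)) h
      contDiff_fst.contMDiff.contMDiffAt
  have h2 : ContMDiffAt 𝓘(ℝ, E × E) 𝓘(ℝ, E) ∞
      (fun p : E × E => (extChartAt 𝓘(ℝ, E) (1 : G)).symm p.2) (chartOne E G, chartOne E G) :=
    ContMDiffAt.comp (f := Prod.snd) (x := (chartOne E G, chartOne E G)) h
      contDiff_snd.contMDiff.contMDiffAt
  refine ContMDiffAt.comp_of_eq (x := (chartOne E G, chartOne E G))
    (contMDiffAt_extChartAt (I := 𝓘(ℝ, E)) (n := ∞) (x := (1 : G))) (h1.mul h2) ?_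
  rw [extChartAt_symm_chartOne, one_mul]

theorem contDiffAt_leftFrame : ContDiffAt ℝ ∞ (leftFrame E G) (chartOne E G) :=
  ContDiffAt.fderiv (contDiffAt_chartMul (E := E) (G := G)) contDiffAt_const (by simp)

theorem hasMFDerivAt_extChartAt_symm_chartOne :
    HasMFDerivAt 𝓘(ℝ, E) 𝓘(ℝ, E) (extChartAt 𝓘(ℝ, E) (1 : G)).symm (chartOne E G)
      (ContinuousLinearMap.id ℝ E) := by
  have hM1 : IsManifold 𝓘(ℝ, E) 1 G := IsManifold.of_le (n := ∞) (by simp)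
  have h := contMDiffAt_extChartAt_symm_of_mem_target (G := G) (chartOne_mem_target (E := E))
  have h1 := (h.mdifferentiableAt (by simp)).hasMFDerivAt
  have h2 := mfderivWithin_range_extChartAt_symm (I := 𝓘(ℝ, E)) (x := (1 : G))
  rw [modelWithCornersSelf_coe, Set.range_id, mfderivWithin_univ] at h2
  exact h2 ▸ h1

theorem mdifferentiableAt_mul_left (g a : G) :
    MDifferentiableAt 𝓘(ℝ, E) 𝓘(ℝ, E) (fun b : G => g * b) a :=
  (contMDiff_mul_left (I := 𝓘(ℝ, E)) (n := ∞) (a := g)).mdifferentiableAt (by simp)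

/-- The derivative of the preferred chart at the identity, at a point in its domain. -/
theorem hasMFDerivAt_extChartAt_one {g : G} (hg : g ∈ (extChartAt 𝓘(ℝ, E) (1 : G)).source) :
    HasMFDerivAt 𝓘(ℝ, E) 𝓘(ℝ, E) (extChartAt 𝓘(ℝ, E) (1 : G)) g
      (mfderiv 𝓘(ℝ, E) 𝓘(ℝ, E) (extChartAt 𝓘(ℝ, E) (1 : G)) g) := by
  have hM1 : IsManifold 𝓘(ℝ, E) 1 G := IsManifold.of_le (n := ∞) (by simp)
  exact (mdifferentiableAt_extChartAt (I := 𝓘(ℝ, E)) (by simpa using hg)).hasMFDerivAt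

/-- Chain rule for chart ∘ L_g ∘ chart⁻¹ at the coordinates of the identity, where chart⁻¹ has
derivative the identity. -/
theorem leftFrame_apply {g : G} (hg : g ∈ (extChartAt 𝓘(ℝ, E) (1 : G)).source) (a : E) :
    leftFrame E G (extChartAt 𝓘(ℝ, E) (1 : G) g) a =
      mfderiv 𝓘(ℝ, E) 𝓘(ℝ, E) (extChartAt 𝓘(ℝ, E) (1 : G)) g
        (mulInvariantVectorField (I := 𝓘(ℝ, E)) (a : GroupLieAlgebra 𝓘(ℝ, E) G) g) := by
  have h1 := hasMFDerivAt_extChartAt_symm_chartOne (E := E) (G := G)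
  have h2 : HasMFDerivAt 𝓘(ℝ, E) 𝓘(ℝ, E) (fun b : G => g * b)
      ((extChartAt 𝓘(ℝ, E) (1 : G)).symm (chartOne E G))
      (mfderiv 𝓘(ℝ, E) 𝓘(ℝ, E) (fun b : G => g * b) 1) := by
    rw [extChartAt_symm_chartOne]
    exact (mdifferentiableAt_mul_left g 1).hasMFDerivAt
  have h3 : HasMFDerivAt 𝓘(ℝ, E) 𝓘(ℝ, E) (extChartAt 𝓘(ℝ, E) (1 : G))
      (g * (extChartAt 𝓘(ℝ, E) (1 : G)).symm (chartOne E G))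
      (mfderiv 𝓘(ℝ, E) 𝓘(ℝ, E) (extChartAt 𝓘(ℝ, E) (1 : G)) g) := by
    rw [extChartAt_symm_chartOne, mul_one]
    exact hasMFDerivAt_extChartAt_one hg
  have h4 := h3.comp (chartOne E G) (h2.comp (chartOne E G) h1)
  rw [hasMFDerivAt_iff_hasFDerivAt] at h4
  have h5 : chartMul E G (extChartAt 𝓘(ℝ, E) (1 : G) g) =
      extChartAt 𝓘(ℝ, E) (1 : G) ∘ (fun b : G => g * b) ∘ (extChartAt 𝓘(ℝ, E) (1 : G)).symm := by
    ext ζ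
    simp only [chartMul, Function.comp, (extChartAt 𝓘(ℝ, E) (1 : G)).left_inv hg]
  rw [← h5] at h4
  obtain ⟨L, hL, hLa⟩ : ∃ L : E →L[ℝ] E,
      HasFDerivAt (chartMul E G (extChartAt 𝓘(ℝ, E) (1 : G) g)) L (chartOne E G) ∧
      L a = mfderiv 𝓘(ℝ, E) 𝓘(ℝ, E) (extChartAt 𝓘(ℝ, E) (1 : G)) g
        (mulInvariantVectorField (I := 𝓘(ℝ, E)) (a : GroupLieAlgebra 𝓘(ℝ, E) G) g) := ⟨_, h4, rfl⟩
  rw [leftFrame, hL.fderiv, hLa]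

/-- In the chart, left-invariant fields are ξ ↦ Λ(ξ)a with Λ the left frame and Λ = id at the
identity, so the coordinate formula DW(V) - DV(W) for the bracket only involves the derivative of Λ.
-/
theorem bracket_eq_fderiv_leftFrame (a b : GroupLieAlgebra 𝓘(ℝ, E) G) :
    (⁅a, b⁆ : GroupLieAlgebra 𝓘(ℝ, E) G) =
      (fderiv ℝ (leftFrame E G) (chartOne E G) (a : E) (b : E) -
        fderiv ℝ (leftFrame E G) (chartOne E G) (b : E) (a : E) : E) := by
  have hM1 : IsManifold 𝓘(ℝ, E) 1 G := IsManifold.of_le (n := ∞) (by simp)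
  have key : ∀ a : GroupLieAlgebra 𝓘(ℝ, E) G,
      VectorField.mpullbackWithin 𝓘(ℝ, E) 𝓘(ℝ, E) (extChartAt 𝓘(ℝ, E) (1 : G)).symm
        (mulInvariantVectorField a) (Set.range 𝓘(ℝ, E)) =ᶠ[𝓝 (chartOne E G)]
      fun ξ => leftFrame E G ξ (a : E) := by
    intro a
    filter_upwards [target_mem_nhds_chartOne (E := E) (G := G)] with ξ hξ
    have h1 := leftFrame_apply ((extChartAt 𝓘(ℝ, E) (1 : G)).map_target hξ) a
    rw [(extChartAt 𝓘(ℝ, E) (1 : G)).right_inv hξ] at h1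
    rw [h1, VectorField.mpullbackWithin_apply]
    have h2 := ContinuousLinearMap.inverse_eq
      (mfderivWithin_extChartAt_symm_comp_mfderiv_extChartAt (I := 𝓘(ℝ, E)) hξ)
      (mfderiv_extChartAt_comp_mfderivWithin_extChartAt_symm (I := 𝓘(ℝ, E)) hξ)
    rw [h2]
  rw [GroupLieAlgebra.bracket_def, ← VectorField.mlieBracketWithin_univ,
    VectorField.mlieBracketWithin_apply, mfderiv_extChartAt_self]
  have h3 : (ContinuousLinearMap.id ℝ (TangentSpace 𝓘(ℝ, E) (1 : G))).inverse =
      ContinuousLinearMap.id ℝ E :=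
    ContinuousLinearMap.inverse_id
  have hd : DifferentiableAt ℝ (leftFrame E G) (chartOne E G) :=
    contDiffAt_leftFrame.differentiableAt (by simp)
  have hd' : ∀ a : E, HasFDerivAt (fun ξ => leftFrame E G ξ a)
     ((fderiv ℝ (leftFrame E G) (chartOne E G)).flip a) (chartOne E G) := fun a => by
    have := hd.hasFDerivAt.clm_apply (hasFDerivAt_const a (chartOne E G))
    simpa using this
  have h4 : ∀ V W : E → E, (V =ᶠ[𝓝 (chartOne E G)] fun ξ => leftFrame E G ξ (a : E)) →
      (W =ᶠ[𝓝 (chartOne E G)] fun ξ => leftFrame E G ξ (b : E)) →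
      VectorField.lieBracketWithin ℝ V W
        ((extChartAt 𝓘(ℝ, E) (1 : G)).symm ⁻¹' Set.univ ∩ Set.range 𝓘(ℝ, E)) (chartOne E G) =
      fderiv ℝ (leftFrame E G) (chartOne E G) (a : E) (b : E) -
        fderiv ℝ (leftFrame E G) (chartOne E G) (b : E) (a : E) := by
    intro V W hV hW
    have : (extChartAt 𝓘(ℝ, E) (1 : G)).symm ⁻¹' Set.univ ∩ Set.range 𝓘(ℝ, E) = Set.univ := by simp
    rw [this, VectorField.lieBracketWithin_univ,
      Filter.EventuallyEq.lieBracket_vectorField_eq hV hW, VectorField.lieBracket,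
      (hd' a).fderiv, (hd' b).fderiv, leftFrame_chartOne]
    rfl
  exact (congrArg _ (h4 _ _ (key a) (key b))).trans (congrArg (fun f : E →L[ℝ] E => f _) h3)

end LieGroup

/-! ### The Maurer-Cartan form and its structure equation -/

section MaurerCartan

open Filter Topology

variable {E : Type*} [NormedAddCommGroup E] [NormedSpace ℝ E]
  {G : Type*} [TopologicalSpace G] [Group G] [ChartedSpace E G]
  {E' : Type*} [NormedAddCommGroup E'] [NormedSpace ℝ E']

/-- The bracket of the Lie algebra of `G`, as an operation on the model space. -/
def groupBracket (E : Type*) [NormedAddCommGroup E] [NormedSpace ℝ E]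
    (G : Type*) [TopologicalSpace G] [Group G] [ChartedSpace E G] (a b : E) : E :=
  lieModel E G ⁅(lieModel E G).symm a, (lieModel E G).symm b⁆

/-- The pullback of the Maurer-Cartan form of `G` under a map `c` from a vector space to `G`. -/
def maurerCartan (E : Type*) [NormedAddCommGroup E] [NormedSpace ℝ E]
    {G : Type*} [TopologicalSpace G] [Group G] [ChartedSpace E G]
    {E' : Type*} [NormedAddCommGroup E'] [NormedSpace ℝ E'] (c : E' → G) (x : E') : E' →L[ℝ] E :=
  ContinuousLinearMap.comp (M₂ := E)
    (mfderiv 𝓘(ℝ, E) 𝓘(ℝ, E) (fun b : G => (c x)⁻¹ * b) (c x))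
    (mfderiv 𝓘(ℝ, E') 𝓘(ℝ, E) c x)

variable [LieGroup 𝓘(ℝ, E) ∞ G]

theorem mulInvariantVectorField_mfderiv_inv_mul (g : G) (v : TangentSpace 𝓘(ℝ, E) g) (a : E)
    (ha : a = mfderiv 𝓘(ℝ, E) 𝓘(ℝ, E) (fun b : G => g⁻¹ * b) g v) :
    mulInvariantVectorField (I := 𝓘(ℝ, E)) (a : GroupLieAlgebra 𝓘(ℝ, E) G) g = v := by
  have h1 : HasMFDerivAt 𝓘(ℝ, E) 𝓘(ℝ, E) (fun b : G => g * b) (g⁻¹ * g)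
      (mfderiv 𝓘(ℝ, E) 𝓘(ℝ, E) (fun b : G => g * b) 1) := by
    rw [inv_mul_cancel]
    exact (mdifferentiableAt_mul_left g 1).hasMFDerivAt
  have h2 := h1.comp g (mdifferentiableAt_mul_left g⁻¹ g).hasMFDerivAt
  have h3 : (fun b : G => g * b) ∘ (fun b : G => g⁻¹ * b) = id := by
    ext b; simp
  rw [h3] at h2
  have h4 := hasMFDerivAt_unique h2 (hasMFDerivAt_id g)
  subst ha
  exact DFunLike.congr_fun h4 v

/-- With k = chart ∘ c this is Λ(k) ω = Dk: the left-invariant field generated by ω(w) passes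
through dc(w). Differentiating it gives the structure equation. -/
theorem leftFrame_maurerCartan {c : E' → G} {x : E'}
    (hx : c x ∈ (extChartAt 𝓘(ℝ, E) (1 : G)).source)
    (hc : MDifferentiableAt 𝓘(ℝ, E') 𝓘(ℝ, E) c x) (w : E') :
    leftFrame E G (extChartAt 𝓘(ℝ, E) (1 : G) (c x)) (maurerCartan E c x w) =
      fderiv ℝ (extChartAt 𝓘(ℝ, E) (1 : G) ∘ c) x w := by
  refine (leftFrame_apply hx _).trans ((congrArg _ (mulInvariantVectorField_mfderiv_inv_mul (c x)
    (mfderiv 𝓘(ℝ, E') 𝓘(ℝ, E) c x w) _ rfl)).trans ?_)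
  have h := (hasMFDerivAt_extChartAt_one hx).comp x hc.hasMFDerivAt
  rw [hasMFDerivAt_iff_hasFDerivAt] at h
  obtain ⟨L, hL, hLa⟩ : ∃ L : E' →L[ℝ] E,
      HasFDerivAt (extChartAt 𝓘(ℝ, E) (1 : G) ∘ c) L x ∧
      L w = mfderiv 𝓘(ℝ, E) 𝓘(ℝ, E) (extChartAt 𝓘(ℝ, E) (1 : G)) (c x)
        (mfderiv 𝓘(ℝ, E') 𝓘(ℝ, E) c x w) := ⟨_, h, rfl⟩
  rw [hL.fderiv, hLa]

/-- The Maurer-Cartan structure equation, at a point where the map takes the value `1`. -/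
theorem exists_hasFDerivAt_maurerCartan [CompleteSpace E] {c : E' → G} {x₀ : E'}
    (hc : ContMDiffAt 𝓘(ℝ, E') 𝓘(ℝ, E) ∞ c x₀) (hc1 : c x₀ = 1) :
    ∃ Ω : E' →L[ℝ] E' →L[ℝ] E, HasFDerivAt (maurerCartan E c) Ω x₀ ∧
      ∀ u w, Ω u w - Ω w u =
        -groupBracket E G (maurerCartan E c x₀ u) (maurerCartan E c x₀ w) := by
  set k : E' → E := extChartAt 𝓘(ℝ, E) (1 : G) ∘ c with hk
  have hk0 : k x₀ = chartOne E G := by simp only [hk, Function.comp, hc1]; rfl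
  have hkd : ContDiffAt ℝ ∞ k x₀ := by
    rw [← contMDiffAt_iff_contDiffAt]
    exact ContMDiffAt.comp_of_eq (x := x₀)
      (contMDiffAt_extChartAt (I := 𝓘(ℝ, E)) (n := ∞) (x := (1 : G))) hc hc1
  have hΛ : ContDiffAt ℝ ∞ (fun x => leftFrame E G (k x)) x₀ :=
    ContDiffAt.comp (g := leftFrame E G) x₀ (by rw [hk0]; exact contDiffAt_leftFrame) hkd
  have hΛ0 : leftFrame E G (k x₀) = (ContinuousLinearEquiv.refl ℝ E : E →L[ℝ] E) := by
    rw [hk0, leftFrame_chartOne]; rfl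
  have hcd : ∀ᶠ x in 𝓝 x₀, MDifferentiableAt 𝓘(ℝ, E') 𝓘(ℝ, E) c x := by
    have h1 : ContMDiffAt 𝓘(ℝ, E') 𝓘(ℝ, E) 1 c x₀ := hc.of_le (by simp)
    filter_upwards [(contMDiffAt_iff_contMDiffAt_nhds (n := 1) (by simp)).1 h1] with x hx
      using hx.mdifferentiableAt (by simp)
  have hsrc : ∀ᶠ x in 𝓝 x₀, c x ∈ (extChartAt 𝓘(ℝ, E) (1 : G)).source :=
    hc.continuousAt.preimage_mem_nhds (by
      rw [hc1]; exact extChartAt_source_mem_nhds (I := 𝓘(ℝ, E)) (1 : G))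
  have hfd : ContDiffAt ℝ ∞ (fderiv ℝ k) x₀ := hkd.fderiv_right (by simp)
  have hinv : ContDiffAt ℝ ∞ (fun x => (leftFrame E G (k x)).inverse) x₀ :=
    ContDiffAt.comp (g := ContinuousLinearMap.inverse) x₀
      (by rw [hΛ0]; exact contDiffAt_map_inverse _) hΛ
  have hrange : ∀ᶠ x in 𝓝 x₀, (leftFrame E G (k x)).IsInvertible :=
    hΛ.continuousAt.eventually_mem (s := {A | A.IsInvertible}) (by
      rw [hΛ0]; exact ContinuousLinearEquiv.nhds (ContinuousLinearEquiv.refl ℝ E))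
  have heq : ∀ᶠ x in 𝓝 x₀, (leftFrame E G (k x)).comp (maurerCartan E c x) = fderiv ℝ k x := by
    filter_upwards [hcd, hsrc] with x h1 h2
    ext w
    exact leftFrame_maurerCartan (E := E) h2 h1 w
  -- Solving for the form, ω = Λ(k)⁻¹ Dk, shows that it is differentiable.
  have hmc : maurerCartan E c =ᶠ[𝓝 x₀]
      fun x => (leftFrame E G (k x)).inverse.comp (fderiv ℝ k x) := by
    filter_upwards [heq, hrange] with x h1 h2
    obtain ⟨e, he⟩ := h2
    rw [← h1, ← he]
    ext w
    simp
  have hmcd : DifferentiableAt ℝ (maurerCartan E c) x₀ := by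
    exact ((hinv.differentiableAt (by simp)).clm_comp
      (hfd.differentiableAt (by simp))).congr_of_eventuallyEq hmc
  refine ⟨_, hmcd.hasFDerivAt, fun u w => ?_⟩
  have h1 := (hΛ.differentiableAt (by simp)).hasFDerivAt.clm_comp hmcd.hasFDerivAt
  have h2 := (hfd.differentiableAt (by simp)).hasFDerivAt
  have h3 := h1.unique (h2.congr_of_eventuallyEq heq)
  have h4 : fderiv ℝ (fun x => leftFrame E G (k x)) x₀ =
      (fderiv ℝ (leftFrame E G) (chartOne E G)).comp (fderiv ℝ k x₀) := by
    rw [← hk0]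
    exact fderiv_comp (g := leftFrame E G) x₀
      (by rw [hk0]; exact contDiffAt_leftFrame.differentiableAt (by simp))
      (hkd.differentiableAt (by simp))
  have h5 : maurerCartan E c x₀ = fderiv ℝ k x₀ := by
    have := heq.self_of_nhds
    rw [hΛ0] at this
    simpa using this
  have h6 := hkd.isSymmSndFDerivAt (by
    rw [minSmoothness_of_isRCLikeNormedField]; exact ENat.LEInfty.out)
  -- The product rule for Λ(k) ω = Dk at a point with Λ = id. On antisymmetrising, the symmetric
  -- second derivative of k drops out and the bracket remains.
  have h7 : ∀ u w, fderiv ℝ (maurerCartan E c) x₀ u w = fderiv ℝ (fderiv ℝ k) x₀ u w -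
      fderiv ℝ (leftFrame E G) (chartOne E G) (fderiv ℝ k x₀ u) (fderiv ℝ k x₀ w) := by
    intro u w
    rw [← h3, h4, hΛ0, h5]
    simp
  have h8 : ∀ a b : E, groupBracket E G a b = fderiv ℝ (leftFrame E G) (chartOne E G) a b -
        fderiv ℝ (leftFrame E G) (chartOne E G) b a :=
    fun a b => bracket_eq_fderiv_leftFrame (G := G) (E := E) a b
  rw [h8, h7, h7, h6.eq u w, h5]
  abel

end MaurerCartan

/-! ### A local lift from `G/H` to `G` tangent to `𝔪` -/

section Lift

open Filter Topology

variable {E : Type*} [NormedAddCommGroup E] [NormedSpace ℝ E]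
  {G : Type*} [TopologicalSpace G] [Group G] [ChartedSpace E G]
  {E' : Type*} [NormedAddCommGroup E'] [NormedSpace ℝ E']

theorem mdifferentiable_of_mem_maximalAtlas {M : Type*} [TopologicalSpace M] [ChartedSpace E M]
    [IsManifold 𝓘(ℝ, E) ∞ M] {e : OpenPartialHomeomorph M E}
    (he : e ∈ IsManifold.maximalAtlas 𝓘(ℝ, E) ∞ M) : e.MDifferentiable 𝓘(ℝ, E) 𝓘(ℝ, E) :=
  ⟨(contMDiffOn_of_mem_maximalAtlas he).mdifferentiableOn (by simp),
    (contMDiffOn_symm_of_mem_maximalAtlas he).mdifferentiableOn (by simp)⟩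

theorem maurerCartan_apply_of_eq_one {c : E' → G} {x₀ : E'} (hc1 : c x₀ = 1) (w : E') :
    maurerCartan E c x₀ w = (mfderiv 𝓘(ℝ, E') 𝓘(ℝ, E) c x₀ w : E) := by
  have h : (fun b : G => (c x₀)⁻¹ * b) = id := by ext b; simp [hc1]
  unfold maurerCartan
  rw [h]
  have h2 : mfderiv 𝓘(ℝ, E) 𝓘(ℝ, E) (id : G → G) (c x₀) = ContinuousLinearMap.id ℝ _ := mfderiv_id
  exact congrArg (fun f : E →L[ℝ] E => f _) h2

variable [LieGroup 𝓘(ℝ, E) ∞ G] {H : Subgroup G} [ChartedSpace E' (G ⧸ H)]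

/-- Near the origin of `G/H` there are a chart and a smooth lift of its inverse to `G`, whose
differential at the base point is a linear isomorphism onto `𝔪`. -/
theorem exists_chart_lift [FiniteDimensional ℝ E'] [IsManifold 𝓘(ℝ, E') ∞ (G ⧸ H)]
    (hπ : Manifold.IsSubmersion 𝓘(ℝ, E) 𝓘(ℝ, E') ∞ (fun a : G => (a : G ⧸ H)))
    (D : ReductiveDecomposition E E' H) :
    ∃ e ∈ IsManifold.maximalAtlas 𝓘(ℝ, E') ∞ (G ⧸ H), ∃ x₀ ∈ e.target,
      ∃ (c : E' → G) (L : E' ≃ₗ[ℝ] D.m), ContMDiffAt 𝓘(ℝ, E') 𝓘(ℝ, E) ∞ c x₀ ∧ c x₀ = 1 ∧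
        (∀ᶠ x in 𝓝 x₀, (c x : G ⧸ H) = e.symm x) ∧
        ∀ w, maurerCartan E c x₀ w = lieModel E G (L w) := by
  have hs := hπ.isSubmersionAt 1
  set dom := hs.domChart with hdom
  set e := hs.codChart with he
  have hdomA : dom ∈ IsManifold.maximalAtlas 𝓘(ℝ, E) ∞ G := hs.domChart_mem_maximalAtlas
  have heA : e ∈ IsManifold.maximalAtlas 𝓘(ℝ, E') ∞ (G ⧸ H) := hs.codChart_mem_maximalAtlas
  have hd := mdifferentiable_of_mem_maximalAtlas hdomA
  have hed := mdifferentiable_of_mem_maximalAtlas heA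
  have h1s : (1 : G) ∈ dom.source := hs.mem_domChart_source
  have h1e : ((1 : G) : G ⧸ H) ∈ e.source := hs.mem_codChart_source
  have hwr : ∀ ξ ∈ dom.target, e ((dom.symm ξ : G) : G ⧸ H) = (hs.equiv ξ).1 := by
    intro ξ hξ
    have hξ' : ξ ∈ (hs.domChart.extend 𝓘(ℝ, E)).target := by simpa using hξ
    have := hs.writtenInCharts hξ'
    simpa using this
  have hsrc : ∀ g ∈ dom.source, (g : G ⧸ H) ∈ e.source := fun g hg =>
    hs.source_subset_preimage_source hg
  have hπd : ∀ g : G, MDifferentiableAt 𝓘(ℝ, E) 𝓘(ℝ, E') (fun a : G => (a : G ⧸ H)) g :=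
    fun g => hπ.contMDiff.mdifferentiable (by simp) g
  obtain ⟨A, hA, hAe⟩ : ∃ A : E →L[ℝ] E, HasMFDerivAt 𝓘(ℝ, E) 𝓘(ℝ, E) dom 1 A ∧
      A = mfderiv 𝓘(ℝ, E) 𝓘(ℝ, E) dom 1 := ⟨_, (hd.mdifferentiableAt h1s).hasMFDerivAt, rfl⟩
  obtain ⟨A', hA', hA'e⟩ : ∃ A' : E →L[ℝ] E, HasMFDerivAt 𝓘(ℝ, E) 𝓘(ℝ, E) dom.symm (dom 1) A' ∧
      A' = mfderiv 𝓘(ℝ, E) 𝓘(ℝ, E) dom.symm (dom 1) :=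
    ⟨_, (hd.mdifferentiableAt_symm (dom.map_source h1s)).hasMFDerivAt, rfl⟩
  have hA'A : ∀ v, A' (A v) = v := fun v => by
    have := hd.symm_comp_deriv h1s
    rw [hAe, hA'e]
    exact congrArg (fun f : E →L[ℝ] E => f v) this
  have hAA' : ∀ v, A (A' v) = v := fun v => by
    have := hd.comp_symm_deriv (dom.map_source h1s)
    rw [dom.left_inv h1s] at this
    rw [hAe, hA'e]
    exact congrArg (fun f : E →L[ℝ] E => f v) this
  -- the projection in the charts
  have hproj : ∀ v : GroupLieAlgebra 𝓘(ℝ, E) G, (hs.equiv (A (lieModel E G v))).1 =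
      mfderiv 𝓘(ℝ, E') 𝓘(ℝ, E') e ((1 : G) : G ⧸ H) (projDeriv (E' := E') (E := E) H v) := by
    intro v
    have h1 := (hed.mdifferentiableAt h1e).hasMFDerivAt.comp (1 : G) (hπd 1).hasMFDerivAt
    have h2 : HasMFDerivAt 𝓘(ℝ, E) 𝓘(ℝ, E')
        (((ContinuousLinearMap.fst ℝ E' hs.complement).comp
          (hs.equiv : E →L[ℝ] E' × hs.complement)) ∘ dom) 1
        (((ContinuousLinearMap.fst ℝ E' hs.complement).comp
          (hs.equiv : E →L[ℝ] E' × hs.complement)).comp A) :=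
      (ContinuousLinearMap.hasMFDerivAt _).comp (1 : G) hA
    have h3 : e ∘ (fun a : G => (a : G ⧸ H)) =ᶠ[𝓝 1]
        (((ContinuousLinearMap.fst ℝ E' hs.complement).comp
          (hs.equiv : E →L[ℝ] E' × hs.complement)) ∘ dom) := by
      filter_upwards [dom.open_source.mem_nhds h1s] with g hg
      have := hwr (dom g) (dom.map_source hg)
      rw [dom.left_inv hg] at this
      simpa using this
    have h4 := hasMFDerivAt_unique h1 (h2.congr_of_eventuallyEq h3)
    exact (congrArg (fun f : E →L[ℝ] E' => f v) h4).symm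
  -- `T` is dπ restricted to `𝔪`, read in the charts. It is bijective because `𝔪` is a complement of
  -- ker dπ = `𝔥`.
  obtain ⟨T, hT⟩ : ∃ T : D.m →ₗ[ℝ] E', ∀ z : D.m,
      T z = (hs.equiv (A (lieModel E G z))).1 :=
    ⟨{ toFun := fun z => (hs.equiv (A (lieModel E G z))).1
       map_add' := fun z z' => by simp
       map_smul' := fun t z => by simp }, fun _ => rfl⟩
  have hTinj : Function.Injective T := by
    rw [injective_iff_map_eq_zero]
    intro z hz
    rw [hT, hproj] at hz
    have h0 : projDeriv (E' := E') (E := E) H z = 0 :=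
      (hed.mfderiv_injective h1e) (hz.trans (map_zero _).symm)
    have h1 : (z : GroupLieAlgebra 𝓘(ℝ, E) G) ∈ D.m ⊓ isotropyAlgebra E' H :=
      ⟨z.2, LinearMap.mem_ker.2 h0⟩
    rw [D.isCompl.inf_eq_bot, Submodule.mem_bot] at h1
    exact Subtype.ext h1
  have hTsurj : Function.Surjective T := by
    intro w
    obtain ⟨z, hz, y, hy, hzy⟩ := Submodule.mem_sup.1
      (D.isCompl.sup_eq_top ▸ Submodule.mem_top :
        (lieModel E G).symm (A' (hs.equiv.symm (w, 0))) ∈ D.m ⊔ isotropyAlgebra E' H)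
    refine ⟨⟨z, hz⟩, ?_⟩
    have h1 : A (lieModel E G z) + A (lieModel E G y) = hs.equiv.symm (w, 0) := by
      rw [← map_add, ← map_add, hzy, LinearEquiv.apply_symm_apply, hAA']
    have h2 : (hs.equiv (A (lieModel E G y))).1 = 0 := by
      rw [hproj, LinearMap.mem_ker.1 hy]
      exact map_zero _
    have h3 : (hs.equiv (A (lieModel E G z) + A (lieModel E G y))).1 = w := by rw [h1]; simp
    rw [map_add, Prod.fst_add, h2, add_zero] at h3
    rw [hT, ← h3]
  set L : E' ≃ₗ[ℝ] D.m := (LinearEquiv.ofBijective T ⟨hTinj, hTsurj⟩).symm with hL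
  have hTL : ∀ w, (hs.equiv (A (lieModel E G (L w)))).1 = w := fun w => by
    rw [← hT]
    exact (LinearEquiv.ofBijective T ⟨hTinj, hTsurj⟩).apply_symm_apply w
  obtain ⟨ℓ, hℓ⟩ : ∃ ℓ : E' →L[ℝ] E, ∀ w, ℓ w = A (lieModel E G (L w)) := by
    refine ⟨LinearMap.toContinuousLinearMap
      { toFun := fun w => A (lieModel E G (L w))
        map_add' := fun w w' => by simp
        map_smul' := fun t w => by simp }, fun _ => rfl⟩
  set x₀ : E' := e ((1 : G) : G ⧸ H) with hx₀
  have hdt : dom 1 ∈ dom.target := dom.map_source h1s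
  have haff : ContDiff ℝ ∞ fun x : E' => dom 1 + ℓ (x - x₀) := by fun_prop
  have hpt : dom 1 + ℓ (x₀ - x₀) = dom 1 := by simp
  have hc1 : dom.symm (dom 1 + ℓ (x₀ - x₀)) = 1 := by rw [hpt, dom.left_inv h1s]
  -- The lift is affine in the chart of `G`, with direction `ℓ` chosen along `𝔪`. The projection of
  -- `ℓ` to E' is the identity, so it is a lift of the inverse chart.
  refine ⟨e, heA, x₀, e.map_source h1e, fun x => dom.symm (dom 1 + ℓ (x - x₀)), L, ?_, hc1, ?_, ?_⟩
  · exact ContMDiffAt.comp_of_eq (x := x₀)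
      (contMDiffAt_symm_of_mem_maximalAtlas hdomA hdt) haff.contMDiff.contMDiffAt hpt
  · have hev : ∀ᶠ x in 𝓝 x₀, dom 1 + ℓ (x - x₀) ∈ dom.target :=
      haff.continuous.continuousAt.eventually_mem (by
        rw [hpt]; exact dom.open_target.mem_nhds hdt)
    filter_upwards [hev] with x hx
    have h1 := hwr _ hx
    have h2 := hwr _ hdt
    rw [dom.left_inv h1s] at h2
    have h3 : (hs.equiv (dom 1 + ℓ (x - x₀))).1 = x := by
      rw [map_add, Prod.fst_add, ← h2, hℓ, hTL, ← hx₀, add_sub_cancel]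
    rw [h3] at h1
    rw [← e.left_inv (hsrc _ (dom.map_target hx)), h1]
  · intro w
    rw [maurerCartan_apply_of_eq_one (c := fun x => dom.symm (dom 1 + ℓ (x - x₀))) hc1]
    have h1 : HasMFDerivAt 𝓘(ℝ, E') 𝓘(ℝ, E) (fun x : E' => dom 1 + ℓ (x - x₀)) x₀ ℓ := by
      have : HasFDerivAt (fun x : E' => dom 1 + ℓ (x - x₀)) ℓ x₀ := by
        simpa using (ℓ.hasFDerivAt.comp x₀ ((hasFDerivAt_id x₀).sub_const x₀)).const_add (dom 1)
      exact this.hasMFDerivAt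
    have h2 : HasMFDerivAt 𝓘(ℝ, E) 𝓘(ℝ, E) dom.symm (dom 1 + ℓ (x₀ - x₀)) A' := by
      rw [hpt]; exact hA'
    have h3 := (h2.comp x₀ h1).mfderiv
    have h4 : A' (ℓ w) = lieModel E G (L w) := by rw [hℓ, hA'A]
    rw [← h4]
    exact congrArg (fun f : E' →L[ℝ] E => f w) h3

end Lift

/-! ### Invariant metrics in a moving coframe -/

section Frame

open Filter Topology

variable {E : Type*} [NormedAddCommGroup E] [NormedSpace ℝ E]
  {G : Type*} [TopologicalSpace G] [Group G] [ChartedSpace E G]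
  {E' : Type*} [NormedAddCommGroup E'] [NormedSpace ℝ E']
  {H : Subgroup G} [ChartedSpace E' (G ⧸ H)]

/-- The equation `a = 1` is a hypothesis because the tangent spaces depend on the point; the use is
at (c x)⁻¹ * c x. -/
theorem apply_mfderiv_mk_of_eq_one (F : (p : G ⧸ H) → TangentSpace 𝓘(ℝ, E') p → ℝ) {a : G}
    (ha : a = 1) (w : E) :
    F (a : G ⧸ H) (mfderiv 𝓘(ℝ, E) 𝓘(ℝ, E') (fun b : G => (b : G ⧸ H)) a w) =
      F ((1 : G) : G ⧸ H) (projDeriv (E' := E') H ((lieModel E G).symm w)) := by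
  subst ha
  rfl

theorem apply_congr_of_eq {M : Type*} [TopologicalSpace M] [ChartedSpace E' M]
    (F : (p : M) → TangentSpace 𝓘(ℝ, E') p → ℝ) {p q : M} (h : p = q) {v w : E'} (hvw : v = w) :
    F p v = F q w := by
  subst h hvw
  rfl

/-- The vector and its `𝔪`-component differ by an element of `𝔥`, which dπ kills. -/
theorem normOn_projectionOnto (D : ReductiveDecomposition E E' H)
    (F : (p : G ⧸ H) → TangentSpace 𝓘(ℝ, E') p → ℝ) (v : GroupLieAlgebra 𝓘(ℝ, E) G) :
    D.normOn F (D.m.projectionOnto (isotropyAlgebra E' H) D.isCompl v) =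
      F ((1 : G) : G ⧸ H) (projDeriv (E' := E') H v) := by
  have h : v - (D.m.projectionOnto (isotropyAlgebra E' H) D.isCompl v :
      GroupLieAlgebra 𝓘(ℝ, E) G) ∈ isotropyAlgebra E' H := by
    rw [← Submodule.projectionOnto_apply_eq_zero_iff D.isCompl, map_sub,
      Submodule.projectionOnto_apply_left, sub_self]
  have h2 := LinearMap.mem_ker.1 h
  rw [map_sub, sub_eq_zero] at h2
  rw [ReductiveDecomposition.normOn, h2]

variable [LieGroup 𝓘(ℝ, E) ∞ G]

/-- An invariant metric, in a chart with a local lift `c` to `G`, is the metric at the origin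
applied to the pullback under `c` of the Maurer-Cartan form. -/
theorem coordExpr_eq_of_lift [IsManifold 𝓘(ℝ, E') ∞ (G ⧸ H)]
    (hπ : Manifold.IsSubmersion 𝓘(ℝ, E) 𝓘(ℝ, E') ∞ (fun a : G => (a : G ⧸ H)))
    {F : (p : G ⧸ H) → TangentSpace 𝓘(ℝ, E') p → ℝ} (hFinv : IsInvariantMetric F)
    {e : OpenPartialHomeomorph (G ⧸ H) E'} (he : e ∈ IsManifold.maximalAtlas 𝓘(ℝ, E') ∞ (G ⧸ H))
    {c : E' → G} {x : E'} (hx : x ∈ e.target)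
    (hc : MDifferentiableAt 𝓘(ℝ, E') 𝓘(ℝ, E) c x)
    (hce : ∀ᶠ x' in 𝓝 x, (c x' : G ⧸ H) = e.symm x') (w : E') :
    coordExpr F e x w =
      F ((1 : G) : G ⧸ H) (projDeriv (E' := E') H ((lieModel E G).symm (maurerCartan E c x w))) := by
  have hed := mdifferentiable_of_mem_maximalAtlas he
  have hπd : ∀ g : G, MDifferentiableAt 𝓘(ℝ, E) 𝓘(ℝ, E') (fun a : G => (a : G ⧸ H)) g :=
    fun g => hπ.contMDiff.mdifferentiable (by simp) g
  -- This translation carries the point `e.symm x` back to the origin.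
  set g : G := (c x)⁻¹ with hg
  have h1 := ((hπd (g * c x)).hasMFDerivAt.comp (c x)
    (mdifferentiableAt_mul_left (E := E) g (c x)).hasMFDerivAt).comp x hc.hasMFDerivAt
  -- Differentiability of the translation is read off from the lift: near `e.symm x` it is q ↦ π(g ·
  -- c(e q)).
  have hsm : MDifferentiableAt 𝓘(ℝ, E') 𝓘(ℝ, E') (fun q : G ⧸ H => g • q) (e.symm x) := by
    have h2 : MDifferentiableAt 𝓘(ℝ, E') 𝓘(ℝ, E')
        ((((fun a : G => (a : G ⧸ H)) ∘ fun b => g * b) ∘ c) ∘ e) (e.symm x) := by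
      have h3 : MDifferentiableAt 𝓘(ℝ, E') 𝓘(ℝ, E')
          (((fun a : G => (a : G ⧸ H)) ∘ fun b => g * b) ∘ c) (e (e.symm x)) := by
        rw [e.right_inv hx]
        exact h1.mdifferentiableAt
      exact h3.comp _ (hed.mdifferentiableAt (e.map_target hx))
    refine h2.congr_of_eventuallyEq ?_
    have h4 : Tendsto e (𝓝 (e.symm x)) (𝓝 x) := by
      have := e.continuousAt (e.map_target hx)
      rwa [ContinuousAt, e.right_inv hx] at this
    filter_upwards [h4.eventually hce, e.open_source.mem_nhds (e.map_target hx)] with q hq hqs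
    rw [e.left_inv hqs] at hq
    change g • q = g • ((c (e q) : G) : G ⧸ H)
    rw [hq]
  have h5 := hsm.hasMFDerivAt.comp x (hed.mdifferentiableAt_symm hx).hasMFDerivAt
  have h6 : (fun q : G ⧸ H => g • q) ∘ e.symm =ᶠ[𝓝 x]
      ((fun a : G => (a : G ⧸ H)) ∘ fun b => g * b) ∘ c := by
    filter_upwards [hce] with x' hx'
    simp only [Function.comp]
    rw [← hx']
    rfl
  have h7 := hasMFDerivAt_unique h5 (h1.congr_of_eventuallyEq h6)
  have h8 := hFinv g (e.symm x) (mfderiv 𝓘(ℝ, E') 𝓘(ℝ, E') e.symm x w)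
  have h9 := congrArg (fun f : E' →L[ℝ] E' => f w) h7
  rw [coordExpr, ← h8, ← apply_mfderiv_mk_of_eq_one F (inv_mul_cancel (c x))]
  exact apply_congr_of_eq F h6.self_of_nhds h9

/-- A chart near the origin of `G/H` and a moving coframe `B` on it, normalised at the base point,
in which an invariant metric is given by its restriction to `𝔪`. The exterior derivative of the
coframe at the base point is minus the `𝔪`-bracket. -/
theorem exists_chart_coframe [FiniteDimensional ℝ E] [FiniteDimensional ℝ E']
    [IsManifold 𝓘(ℝ, E') ∞ (G ⧸ H)]
    (hπ : Manifold.IsSubmersion 𝓘(ℝ, E) 𝓘(ℝ, E') ∞ (fun a : G => (a : G ⧸ H)))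
    (D : ReductiveDecomposition E E' H)
    {F : (p : G ⧸ H) → TangentSpace 𝓘(ℝ, E') p → ℝ} (hFinv : IsInvariantMetric F) :
    ∃ e ∈ IsManifold.maximalAtlas 𝓘(ℝ, E') ∞ (G ⧸ H), ∃ x₀ ∈ e.target,
      ∃ (L : E' ≃ₗ[ℝ] D.m) (B : E' → E' →L[ℝ] E') (B' : E' →L[ℝ] E' →L[ℝ] E'),
        HasFDerivAt B B' x₀ ∧ B x₀ = ContinuousLinearMap.id ℝ E' ∧
        (∀ᶠ x in 𝓝 x₀, ∀ w, coordExpr F e x w = D.normOn F (L (B x w))) ∧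
        ∀ u w, L (B' u w - B' w u) = -D.bracket (L u) (L w) := by
  obtain ⟨e, he, x₀, hx₀, c, L, hc, hc1, hce, hL⟩ := exists_chart_lift hπ D
  have hcomp : CompleteSpace E := FiniteDimensional.complete ℝ E
  obtain ⟨Ω, hΩ, hΩb⟩ := exists_hasFDerivAt_maurerCartan (E := E) hc hc1
  set Q := D.m.projectionOnto (isotropyAlgebra E' H) D.isCompl with hQ
  -- The `𝔪`-component, carried to the model space by `L`⁻¹; this makes the coframe the identity at
  -- `x₀`.
  set p : E →L[ℝ] E' := LinearMap.toContinuousLinearMap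
    ((L.symm : D.m →ₗ[ℝ] E') ∘ₗ Q ∘ₗ ((lieModel E G).symm : E →ₗ[ℝ] GroupLieAlgebra 𝓘(ℝ, E) G))
    with hp
  have hpa : ∀ v, L (p v) = Q ((lieModel E G).symm v) := fun v => by simp [hp]
  refine ⟨e, he, x₀, hx₀, L, fun x => p.comp (maurerCartan E c x),
    (ContinuousLinearMap.compL ℝ E' E E' p).comp Ω, ?_, ?_, ?_, ?_⟩
  · exact (ContinuousLinearMap.compL ℝ E' E E' p).hasFDerivAt.comp x₀ hΩ
  · ext w
    apply L.injective
    simp only [ContinuousLinearMap.comp_apply, hpa, hL, LinearEquiv.symm_apply_apply,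
      ContinuousLinearMap.id_apply]
    exact Submodule.projectionOnto_apply_left _ _
  · have hcd : ∀ᶠ x in 𝓝 x₀, MDifferentiableAt 𝓘(ℝ, E') 𝓘(ℝ, E) c x := by
      have h1 : ContMDiffAt 𝓘(ℝ, E') 𝓘(ℝ, E) 1 c x₀ := hc.of_le (by simp)
      filter_upwards [(contMDiffAt_iff_contMDiffAt_nhds (n := 1) (by simp)).1 h1] with x hx
        using hx.mdifferentiableAt (by simp)
    filter_upwards [hcd, e.open_target.mem_nhds hx₀, hce.eventually_nhds] with x h1 h2 h3 w
    rw [coordExpr_eq_of_lift hπ hFinv he h2 h1 h3, ContinuousLinearMap.comp_apply, hpa,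
      normOn_projectionOnto]
  · intro u w
    have h1 : ((ContinuousLinearMap.compL ℝ E' E E' p).comp Ω) u w -
        ((ContinuousLinearMap.compL ℝ E' E E' p).comp Ω) w u = p (Ω u w - Ω w u) := by
      simp
    rw [h1, hΩb, map_neg, map_neg, hpa, groupBracket, hL, hL]
    simp only [LinearEquiv.symm_apply_apply]
    rfl

end Frame

/-! ### Derivatives of `α² ψ(β/α)` and the spray equation -/

section AlphaBeta

open Filter Topology

variable {V : Type*} [NormedAddCommGroup V] [NormedSpace ℝ V]

/-- The ratio `β/α` at `y`, where `α` is the norm of the inner product `a` and `β = a(X, ·)`. -/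
def betaSlope (a : V →L[ℝ] V →L[ℝ] ℝ) (X y : V) : ℝ := a X y / √(a y y)

/-- The derivative at `y` in the direction `w` of `α² ψ(β/α)`, where `ψ₁` is the derivative
of `ψ`. -/
def firstDeriv (a : V →L[ℝ] V →L[ℝ] ℝ) (X : V) (ψ ψ₁ : ℝ → ℝ) (y w : V) : ℝ :=
  (2 * ψ (betaSlope a X y) - betaSlope a X y * ψ₁ (betaSlope a X y)) * a y w +
    √(a y y) * ψ₁ (betaSlope a X y) * a X w

/-- The second derivative at `y` in the directions `u` and `w` of `α² ψ(β/α)`, where `ψ₁` and `ψ₂`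
are the first two derivatives of `ψ`. -/
def secondDeriv (a : V →L[ℝ] V →L[ℝ] ℝ) (X : V) (ψ ψ₁ ψ₂ : ℝ → ℝ) (y u w : V) : ℝ :=
  (2 * ψ (betaSlope a X y) - betaSlope a X y * ψ₁ (betaSlope a X y)) * a u w +
    ψ₂ (betaSlope a X y) * a X u * a X w +
    (ψ₁ (betaSlope a X y) - betaSlope a X y * ψ₂ (betaSlope a X y)) *
      ((a y w * a X u + a y u * a X w) / √(a y y) - betaSlope a X y * a y u * a y w / a y y)

variable {a : V →L[ℝ] V →L[ℝ] ℝ} (hsymm : ∀ u v, a u v = a v u) (hpos : ∀ u, u ≠ 0 → 0 < a u u)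

-- Cauchy-Schwarz, from positivity of a on the vector a(y, y) X - a(X, y) y. It keeps the slope β/α
-- inside the domain of the profile.
include hsymm hpos in
theorem slope_sq_mul_le (X y : V) : (a X y) ^ 2 ≤ a X X * a y y := by
  by_cases hy : y = 0
  · simp [hy]
  have h1 := hpos y hy
  have h2 : 0 ≤ a (a y y • X - a X y • y) (a y y • X - a X y • y) := by
    by_cases hz : a y y • X - a X y • y = 0
    · simp [hz]
    · exact (hpos _ hz).le
  have h3 : a (a y y • X - a X y • y) (a y y • X - a X y • y) =
      a y y * (a X X * a y y - (a X y) ^ 2) := by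
    simp only [map_sub, map_smul, _root_.sub_apply, _root_.smul_apply,
      smul_eq_mul, hsymm y X]
    ring
  rw [h3] at h2
  nlinarith [nonneg_of_mul_nonneg_right h2 h1]

include hsymm hpos in
theorem abs_slope_le (X y : V) : |betaSlope a X y| ≤ √(a X X) := by
  by_cases hy : y = 0
  · simp [hy, betaSlope]
  have h1 := hpos y hy
  rw [betaSlope, abs_div, abs_of_nonneg (Real.sqrt_nonneg _), div_le_iff₀ (Real.sqrt_pos.2 h1),
    ← Real.sqrt_mul' _ h1.le]
  exact Real.abs_le_sqrt (slope_sq_mul_le hsymm hpos X y)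

include hsymm hpos in
theorem slope_mem_Ioo {X : V} {b₀ : ℝ} (hb₀ : √(a X X) < b₀) (y : V) :
    betaSlope a X y ∈ Set.Ioo (-b₀) b₀ :=
  abs_lt.1 ((abs_slope_le hsymm hpos X y).trans_lt hb₀)

theorem hasDerivAt_bilin {γ w : ℝ → V} {γ' w' : V} {t : ℝ} (hγ : HasDerivAt γ γ' t)
    (hw : HasDerivAt w w' t) :
    HasDerivAt (fun τ => a (γ τ) (w τ)) (a γ' (w t) + a (γ t) w') t :=
  (a.hasFDerivAt.comp_hasDerivAt t hγ).clm_apply hw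

include hsymm hpos in
theorem hasDerivAt_sqrt_norm {γ : ℝ → V} {γ' : V} {t : ℝ} (hγ : HasDerivAt γ γ' t)
    (h0 : γ t ≠ 0) :
    HasDerivAt (fun τ => √(a (γ τ) (γ τ))) (a (γ t) γ' / √(a (γ t) (γ t))) t := by
  have h1 := (hasDerivAt_bilin (a := a) hγ hγ).sqrt (hpos _ h0).ne'
  convert h1 using 1
  rw [hsymm γ' (γ t)]
  have := Real.sqrt_pos.2 (hpos _ h0)
  field_simp
  ring

include hsymm hpos in
theorem hasDerivAt_slope (X : V) {γ : ℝ → V} {γ' : V} {t : ℝ} (hγ : HasDerivAt γ γ' t)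
    (h0 : γ t ≠ 0) :
    HasDerivAt (fun τ => betaSlope a X (γ τ))
      (a X γ' / √(a (γ t) (γ t)) - betaSlope a X (γ t) * a (γ t) γ' / a (γ t) (γ t)) t := by
  have h1 := hpos _ h0
  have h2 := Real.sqrt_pos.2 h1
  have h3 := ((a X).hasFDerivAt.comp_hasDerivAt t hγ).fun_div
    (hasDerivAt_sqrt_norm hsymm hpos hγ h0) h2.ne'
  refine HasDerivAt.congr_deriv h3 ?_
  -- With the norm named n and a(γ, γ) replaced by n², the claim is a rational identity in n.
  obtain ⟨n, hn, hn2⟩ : ∃ n, n = √(a (γ t) (γ t)) ∧ a (γ t) (γ t) = n ^ 2 :=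
    ⟨_, rfl, (Real.sq_sqrt h1.le).symm⟩
  simp only [betaSlope, Function.comp]
  rw [← hn] at h2 ⊢
  rw [hn2]
  field_simp

variable {b₀ : ℝ} {X : V} {ψ ψ₁ ψ₂ : ℝ → ℝ}

include hsymm hpos in
theorem hasDerivAt_sq_mul_profile (hb₀ : √(a X X) < b₀)
    (hψ : ∀ s ∈ Set.Ioo (-b₀) b₀, HasDerivAt ψ (ψ₁ s) s)
    {γ : ℝ → V} {γ' : V} {t : ℝ} (hγ : HasDerivAt γ γ' t) (h0 : γ t ≠ 0) :
    HasDerivAt (fun τ => a (γ τ) (γ τ) * ψ (betaSlope a X (γ τ))) (firstDeriv a X ψ ψ₁ (γ t) γ') t := by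
  have h1 := hpos _ h0
  have h2 := Real.sqrt_pos.2 h1
  have h3 := (hasDerivAt_bilin (a := a) hγ hγ).fun_mul
    ((hψ _ (slope_mem_Ioo hsymm hpos hb₀ (γ t))).comp t (hasDerivAt_slope hsymm hpos X hγ h0))
  refine HasDerivAt.congr_deriv h3 ?_
  obtain ⟨n, hn, hn2⟩ : ∃ n, n = √(a (γ t) (γ t)) ∧ a (γ t) (γ t) = n ^ 2 :=
    ⟨_, rfl, (Real.sq_sqrt h1.le).symm⟩
  simp only [firstDeriv, Function.comp]
  rw [← hn] at h2 ⊢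
  rw [hn2, hsymm γ' (γ t)]
  field_simp
  ring

-- The direction w varies with the base point because the spray equation differentiates along s ↦ (y
-- + s v, B'(y)(y + s v)). Constant w gives the fundamental tensor.
include hsymm hpos in
theorem hasDerivAt_firstDeriv (hb₀ : √(a X X) < b₀)
    (hψ : ∀ s ∈ Set.Ioo (-b₀) b₀, HasDerivAt ψ (ψ₁ s) s)
    (hψ₁ : ∀ s ∈ Set.Ioo (-b₀) b₀, HasDerivAt ψ₁ (ψ₂ s) s)
    {γ w : ℝ → V} {γ' w' : V} {t : ℝ} (hγ : HasDerivAt γ γ' t) (hw : HasDerivAt w w' t)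
    (h0 : γ t ≠ 0) :
    HasDerivAt (fun τ => firstDeriv a X ψ ψ₁ (γ τ) (w τ))
      (secondDeriv a X ψ ψ₁ ψ₂ (γ t) γ' (w t) + firstDeriv a X ψ ψ₁ (γ t) w') t := by
  have h1 := hpos _ h0
  have h2 := Real.sqrt_pos.2 h1
  have hs := hasDerivAt_slope hsymm hpos X hγ h0
  have hm := slope_mem_Ioo hsymm hpos hb₀ (γ t)
  have e0 := (hψ _ hm).comp t hs
  have e1 := (hψ₁ _ hm).comp t hs
  have h3 := (((e0.const_mul 2).sub (hs.mul e1)).mul (hasDerivAt_bilin (a := a) hγ hw)).add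
    (((hasDerivAt_sqrt_norm hsymm hpos hγ h0).mul e1).mul
      ((a X).hasFDerivAt.comp_hasDerivAt t hw))
  refine HasDerivAt.congr_deriv h3 ?_
  obtain ⟨n, hn, hn2⟩ : ∃ n, n = √(a (γ t) (γ t)) ∧ a (γ t) (γ t) = n ^ 2 :=
    ⟨_, rfl, (Real.sq_sqrt h1.le).symm⟩
  simp only [firstDeriv, secondDeriv, Function.comp, Pi.mul_apply, Pi.sub_apply]
  rw [← hn] at h2 ⊢
  rw [hn2]
  field_simp
  ring

theorem eventually_add_smul_ne_zero {y : V} (hy : y ≠ 0) (u : V) :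
    ∀ᶠ s : ℝ in 𝓝 0, y + s • u ≠ 0 := by
  have : ContinuousAt (fun s : ℝ => y + s • u) 0 := by fun_prop
  exact this.eventually_ne (by simpa using hy)

theorem hasDerivAt_add_smul (y u : V) (s : ℝ) : HasDerivAt (fun t : ℝ => y + t • u) u s := by
  simpa using ((hasDerivAt_id s).smul_const u).const_add y

include hsymm hpos in
/-- The fundamental tensor of a norm `α √ψ(β/α)`. -/
theorem fundamentalTensor_eq_secondDeriv (hb₀ : √(a X X) < b₀)
    (hψ : ∀ s ∈ Set.Ioo (-b₀) b₀, HasDerivAt ψ (ψ₁ s) s)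
    (hψ₁ : ∀ s ∈ Set.Ioo (-b₀) b₀, HasDerivAt ψ₁ (ψ₂ s) s)
    {f : V → ℝ} (hf : ∀ y, f y ^ 2 = a y y * ψ (betaSlope a X y)) {y : V} (hy : y ≠ 0) (u v : V) :
    fundamentalTensor f y u v = 1 / 2 * secondDeriv a X ψ ψ₁ ψ₂ y u v := by
  rw [fundamentalTensor]
  congr 1
  have h1 : (fun s : ℝ => deriv (fun t : ℝ => f (y + s • u + t • v) ^ 2) 0) =ᶠ[𝓝 0]
      fun s => firstDeriv a X ψ ψ₁ (y + s • u) v := by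
    filter_upwards [eventually_add_smul_ne_zero hy u] with s hs
    simp only [hf]
    have := hasDerivAt_sq_mul_profile hsymm hpos hb₀ hψ (hasDerivAt_add_smul (y + s • u) v 0)
      (by simpa using hs)
    simpa using this.deriv
  rw [h1.deriv_eq]
  have h2 := hasDerivAt_firstDeriv hsymm hpos hb₀ hψ hψ₁ (hasDerivAt_add_smul y u 0)
    (hasDerivAt_const (0 : ℝ) v) (by simpa using hy)
  rw [h2.deriv]
  simp [firstDeriv]

include hsymm hpos in
/-- The spray equation of a metric which is given by a norm `α √ψ(β/α)` in a moving coframe,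
tested against a vector orthogonal to the velocity and to `X`. -/
theorem spray_eq_of_coframe (hb₀ : √(a X X) < b₀)
    (hψ : ∀ s ∈ Set.Ioo (-b₀) b₀, HasDerivAt ψ (ψ₁ s) s)
    (hψ₁ : ∀ s ∈ Set.Ioo (-b₀) b₀, HasDerivAt ψ₁ (ψ₂ s) s)
    {f : V → ℝ} (hf : ∀ y, f y ^ 2 = a y y * ψ (betaSlope a X y))
    {F : V → V → ℝ} {x₀ : V} {B : V → V →L[ℝ] V} {B' : V →L[ℝ] V →L[ℝ] V}
    (hB : HasFDerivAt B B' x₀) (hB0 : B x₀ = ContinuousLinearMap.id ℝ V)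
    (hF : ∀ᶠ x in 𝓝 x₀, ∀ w, F x w = f (B x w)) {y W v : V} (hy : y ≠ 0)
    (hspray : IsSprayCoefficient F x₀ y W) (hyv : a y v = 0) (hXv : a X v = 0) :
    √(a y y) * ψ₁ (betaSlope a X y) * a X (B' y v - B' v y) =
      (2 * ψ (betaSlope a X y) - betaSlope a X y * ψ₁ (betaSlope a X y)) *
        (2 * a W v - a (B' y y) v - a y (B' y v - B' v y)) := by
  have hF0 : F x₀ = f := by
    ext w
    rw [hF.self_of_nhds w, hB0, ContinuousLinearMap.id_apply]
  have hBd : ∀ u w : V, HasDerivAt (fun t : ℝ => B (x₀ + t • u) w) (B' u w) 0 := by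
    intro u w
    have h1 : HasDerivAt (fun t : ℝ => B (x₀ + t • u)) (B' u) 0 := by
      have := hasDerivAt_add_smul x₀ u 0
      exact HasFDerivAt.comp_hasDerivAt (l := B) (0 : ℝ) (by simpa using hB) this
    simpa using h1.clm_apply (hasDerivAt_const (0 : ℝ) w)
  have hFt : ∀ u : V, ∀ᶠ t : ℝ in 𝓝 0, ∀ w, F (x₀ + t • u) w = f (B (x₀ + t • u) w) := by
    intro u
    have h1 : Tendsto (fun t : ℝ => x₀ + t • u) (𝓝 0) (𝓝 x₀) := by
      have := (hasDerivAt_add_smul x₀ u 0).continuousAt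
      simpa [ContinuousAt] using this
    exact h1.eventually hF
  have hone : ∀ u w : V, w ≠ 0 →
      deriv (fun t : ℝ => F (x₀ + t • u) w ^ 2) 0 = firstDeriv a X ψ ψ₁ w (B' u w) := by
    intro u w hw
    have h1 : (fun t : ℝ => F (x₀ + t • u) w ^ 2) =ᶠ[𝓝 0] fun t =>
        a (B (x₀ + t • u) w) (B (x₀ + t • u) w) * ψ (betaSlope a X (B (x₀ + t • u) w)) := by
      filter_upwards [hFt u] with t ht
      rw [ht, hf]
    rw [h1.deriv_eq]
    have h2 := hasDerivAt_sq_mul_profile hsymm hpos hb₀ hψ (hBd u w) (by simpa [hB0] using hw)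
    simpa [hB0] using h2.deriv
  have h1 : (fun s : ℝ => deriv (fun t : ℝ => F (x₀ + t • y) (y + s • v) ^ 2) 0) =ᶠ[𝓝 0]
      fun s => firstDeriv a X ψ ψ₁ (y + s • v) (B' y (y + s • v)) := by
    filter_upwards [eventually_add_smul_ne_zero hy v] with s hs using hone y _ hs
  have h2 := hasDerivAt_firstDeriv hsymm hpos hb₀ hψ hψ₁ (hasDerivAt_add_smul y v 0)
    ((B' y).hasFDerivAt.comp_hasDerivAt 0 (hasDerivAt_add_smul y v 0)) (by simpa using hy)
  have h3 := hspray v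
  rw [h1.deriv_eq, hone v y hy, hF0,
    fundamentalTensor_eq_secondDeriv hsymm hpos hb₀ hψ hψ₁ hf hy] at h3
  have h4 := h2.deriv
  simp only [Function.comp_def] at h4
  rw [h4] at h3
  -- As v is orthogonal to y and X, only the leading coefficient 2ψ - s ψ' of the fundamental tensor
  -- survives on the left.
  simp only [firstDeriv, secondDeriv, zero_smul, add_zero, hyv, hXv, hsymm v (B' y y)] at h3
  simp only [map_sub]
  linear_combination (-4) * h3

end AlphaBeta

/-! ### Differential equations with Riemannian profiles -/

section Profile

open Filter Topology

/-- The mean value theorem on each side of 0. The point 0 is exempt because s ψ''' = 0 gives nothing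
there. -/
theorem eq_apply_zero_of_hasDerivAt_zero {g : ℝ → ℝ} {b : ℝ} (hg : ContinuousOn g (Set.Icc (-b) b))
    (hg' : ∀ s ∈ Set.Ioo (-b) b, s ≠ 0 → HasDerivAt g 0 s) {s : ℝ} (hs : s ∈ Set.Icc (-b) b) :
    g s = g 0 := by
  rcases lt_trichotomy s 0 with h | h | h
  · obtain ⟨c, hc, hc'⟩ := exists_hasDerivAt_eq_slope g (fun _ => 0) h
      (hg.mono (Set.Icc_subset_Icc hs.1 (by linarith [hs.1, hs.2])))
      (fun t ht => hg' t ⟨by linarith [hs.1, ht.1], by linarith [ht.2, hs.1]⟩ ht.2.ne)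
    rw [eq_div_iff (by linarith)] at hc'
    linarith
  · rw [h]
  · obtain ⟨c, hc, hc'⟩ := exists_hasDerivAt_eq_slope g (fun _ => 0) h
      (hg.mono (Set.Icc_subset_Icc (by linarith [hs.1, hs.2]) hs.2))
      (fun t ht => hg' t ⟨by linarith [hs.2, ht.1], by linarith [ht.2, hs.2]⟩ ht.1.ne')
    rw [eq_div_iff (by linarith)] at hc'
    linarith

variable {b b₀ : ℝ} {ψ ψ₁ ψ₂ ψ₃ : ℝ → ℝ}

theorem Icc_subset_Ioo_neg (hbb : b < b₀) : Set.Icc (-b) b ⊆ Set.Ioo (-b₀) b₀ :=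
  fun _ hs => ⟨by linarith [hs.1], by linarith [hs.2]⟩

/-- A positive solution of `ψ' = k s (2 ψ - s ψ')` is a polynomial in `s²` of degree one. -/
theorem exists_quadratic_of_deriv_eq (hb : 0 < b) (hbb : b < b₀)
    (hψpos : ∀ s ∈ Set.Ioo (-b₀) b₀, 0 < ψ s)
    (hψ : ∀ s ∈ Set.Ioo (-b₀) b₀, HasDerivAt ψ (ψ₁ s) s)
    (hψ₁ : ∀ s ∈ Set.Ioo (-b₀) b₀, HasDerivAt ψ₁ (ψ₂ s) s)
    {k : ℝ} (h : ∀ s ∈ Set.Ioo (-b) b, ψ₁ s = k * s * (2 * ψ s - s * ψ₁ s)) :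
    ∃ A C : ℝ, ∀ s ∈ Set.Icc (-b) b, ψ s = A + C * s ^ 2 := by
  have hsub := Icc_subset_Ioo_neg hbb
  have hc : ContinuousOn ψ (Set.Icc (-b) b) := fun s hs =>
    (hψ s (hsub hs)).continuousAt.continuousWithinAt
  have hc₁ : ContinuousOn ψ₁ (Set.Icc (-b) b) := fun s hs =>
    (hψ₁ s (hsub hs)).continuousAt.continuousWithinAt
  -- The equation extends to the end points ±b by continuity; they are the slopes attained on
  -- multiples of X.
  have h' : Set.EqOn ψ₁ (fun s => k * s * (2 * ψ s - s * ψ₁ s)) (Set.Icc (-b) b) := by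
    refine Set.EqOn.of_subset_closure (s := Set.Ioo (-b) b) h hc₁ (by fun_prop)
      Set.Ioo_subset_Icc_self ?_
    rw [closure_Ioo (by linarith)]
  -- The equation reads (1 + k s²) ψ' = 2 k s ψ. A zero of 1 + k s² would force k s = 0 by
  -- positivity of ψ, hence 1 = 0.
  have hne : ∀ s ∈ Set.Icc (-b) b, 1 + k * s ^ 2 ≠ 0 := by
    intro s hs h0
    have h1 : ψ₁ s = k * s * (2 * ψ s - s * ψ₁ s) := h' hs
    have h2 : (k * s) * ψ s = 0 := by linear_combination -h1 / 2 + h0 * ψ₁ s / 2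
    have h3 := (mul_eq_zero.1 h2).resolve_right (hψpos s (hsub hs)).ne'
    have h4 : (1 : ℝ) = 0 := by linear_combination h0 - h3 * s
    exact one_ne_zero h4
  have hquot : ∀ s ∈ Set.Icc (-b) b, ψ s / (1 + k * s ^ 2) = ψ 0 / (1 + k * 0 ^ 2) := by
    intro s hs
    refine eq_apply_zero_of_hasDerivAt_zero (g := fun s => ψ s / (1 + k * s ^ 2))
      (hc.div (by fun_prop) hne) (fun t ht _ => ?_) hs
    have h1 : HasDerivAt (fun s : ℝ => 1 + k * s ^ 2) (k * (2 * t)) t := by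
      have := (((hasDerivAt_id t).fun_pow 2).const_mul k).const_add 1
      simpa using this
    have ht' := Set.Ioo_subset_Icc_self ht
    refine ((hψ t (hsub ht')).fun_div h1 (hne t ht')).congr_deriv ?_
    rw [div_eq_zero_iff]
    left
    linear_combination h t ht
  refine ⟨ψ 0, ψ 0 * k, fun s hs => ?_⟩
  have := hquot s hs
  rw [div_eq_iff (hne s hs)] at this
  rw [this]
  ring

/-- A solution of `ψ' = s ψ''` is a polynomial in `s²` of degree one. -/
theorem exists_quadratic_of_deriv_eq_mul_deriv (hbb : b < b₀)
    (hψ : ∀ s ∈ Set.Ioo (-b₀) b₀, HasDerivAt ψ (ψ₁ s) s)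
    (hψ₁ : ∀ s ∈ Set.Ioo (-b₀) b₀, HasDerivAt ψ₁ (ψ₂ s) s)
    (hψ₂ : ∀ s ∈ Set.Ioo (-b₀) b₀, HasDerivAt ψ₂ (ψ₃ s) s)
    (h : ∀ s ∈ Set.Ioo (-b) b, ψ₁ s - s * ψ₂ s = 0) :
    ∃ A C : ℝ, ∀ s ∈ Set.Icc (-b) b, ψ s = A + C * s ^ 2 := by
  have hsub := Icc_subset_Ioo_neg hbb
  -- Differentiating ψ' - s ψ'' = 0 gives s ψ''' = 0, so ψ'' is constant.
  have h2 : ∀ s ∈ Set.Icc (-b) b, ψ₂ s = ψ₂ 0 := by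
    intro s hs
    refine eq_apply_zero_of_hasDerivAt_zero
      (fun t ht => (hψ₂ t (hsub ht)).continuousAt.continuousWithinAt) (fun t ht ht0 => ?_) hs
    have ht' := hsub (Set.Ioo_subset_Icc_self ht)
    have h3 := (hψ₁ t ht').fun_sub ((hasDerivAt_id t).fun_mul (hψ₂ t ht'))
    have h4 : (fun s => ψ₁ s - id s * ψ₂ s) =ᶠ[𝓝 t] fun _ => 0 := by
      filter_upwards [isOpen_Ioo.mem_nhds ht] with s hs using h s hs
    have h5 := h3.unique ((hasDerivAt_const t (0 : ℝ)).congr_of_eventuallyEq h4)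
    have h6 : t * ψ₃ t = 0 := by simp only [id] at h5; linarith
    exact (mul_eq_zero.1 h6).resolve_left ht0 ▸ hψ₂ t ht'
  refine ⟨ψ 0, ψ₂ 0 / 2, fun s hs => ?_⟩
  have h7 : ψ s - ψ₂ 0 / 2 * s ^ 2 = ψ 0 - ψ₂ 0 / 2 * 0 ^ 2 := by
    refine eq_apply_zero_of_hasDerivAt_zero (g := fun s => ψ s - ψ₂ 0 / 2 * s ^ 2)
      (fun t ht => ((hψ t (hsub ht)).continuousAt.sub (by fun_prop)).continuousWithinAt)
      (fun t ht _ => ?_) hs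
    have ht' := Set.Ioo_subset_Icc_self ht
    have h1 : HasDerivAt (fun s : ℝ => ψ₂ 0 / 2 * s ^ 2) (ψ₂ 0 / 2 * (2 * t)) t := by
      have := ((hasDerivAt_id t).fun_pow 2).const_mul (ψ₂ 0 / 2)
      simpa using this
    refine ((hψ t (hsub ht')).fun_sub h1).congr_deriv ?_
    have := h t ht
    rw [h2 t ht'] at this
    linarith
  linarith

/-- A function on `(-1, 1)` is linear if, multiplied with some nonzero linear form on the unit
circle, it is a quadratic form. -/
theorem exists_linear_of_circle {Q : ℝ → ℝ} (hQ : ContinuousAt Q 0) {A B k₁ k₂ k₃ : ℝ}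
    (h : ∀ p r : ℝ, p ^ 2 + r ^ 2 = 1 →
      Q p * (p * A + r * B) = p ^ 2 * k₁ + p * r * k₂ + r ^ 2 * k₃)
    (hAB : A ≠ 0 ∨ B ≠ 0) : ∃ k : ℝ, ∀ p ∈ Set.Ioo (-1 : ℝ) 1, Q p = k * p := by
  have hr : ∀ p ∈ Set.Ioo (-1 : ℝ) 1, ∃ r : ℝ, 0 < r ∧ p ^ 2 + r ^ 2 = 1 := by
    intro p hp
    have h1 : 0 < 1 - p ^ 2 := by nlinarith [hp.1, hp.2]
    exact ⟨√(1 - p ^ 2), Real.sqrt_pos.2 h1, by rw [Real.sq_sqrt h1.le]; ring⟩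
  rcases hAB with hA | hB
  -- At p = 0 the left side changes sign with r = ±1 and the right side does not. Elsewhere, adding
  -- the identities at (p, r) and (p, -r) isolates A; in the other case subtracting them isolates B.
  · have hk₃ : k₃ = 0 := by
      have h1 := h 0 1 (by norm_num)
      have h2 := h 0 (-1) (by norm_num)
      linarith
    have h1 : ∀ p ∈ Set.Ioo (-1 : ℝ) 1, p ≠ 0 → Q p = k₁ / A * p := by
      intro p hp hp0
      obtain ⟨r, hr0, hpr⟩ := hr p hp
      have h2 := h p r hpr
      have h3 := h p (-r) (by linarith [neg_sq r])
      rw [hk₃] at h2 h3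
      have h4 : p * (Q p * A - k₁ * p) = 0 := by linear_combination (h2 + h3) / 2
      have h5 := (mul_eq_zero.1 h4).resolve_left hp0
      field_simp
      linarith
    refine ⟨k₁ / A, fun p hp => ?_⟩
    by_cases hp0 : p = 0
    · subst hp0
      have h2 : Tendsto Q (𝓝[≠] 0) (𝓝 (Q 0)) := hQ.tendsto.mono_left nhdsWithin_le_nhds
      have h3 : Tendsto (fun p => k₁ / A * p) (𝓝[≠] 0) (𝓝 (k₁ / A * 0)) :=
        (Continuous.tendsto (by fun_prop) 0).mono_left nhdsWithin_le_nhds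
      refine tendsto_nhds_unique (h2.congr' ?_) h3
      filter_upwards [self_mem_nhdsWithin, nhdsWithin_le_nhds (isOpen_Ioo.mem_nhds hp)] with q h4 h5
        using h1 q h5 h4
    · exact h1 p hp hp0
  · refine ⟨k₂ / B, fun p hp => ?_⟩
    obtain ⟨r, hr0, hpr⟩ := hr p hp
    have h2 := h p r hpr
    have h3 := h p (-r) (by linarith [neg_sq r])
    have h4 : r * (Q p * B - k₂ * p) = 0 := by linear_combination (h2 - h3) / 2
    have h5 := (mul_eq_zero.1 h4).resolve_left hr0.ne'
    field_simp
    linarith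

end Profile

/-! ### Closed form or Riemannian profile -/

section Rigidity

variable {V : Type*} [NormedAddCommGroup V] [NormedSpace ℝ V]
  {a : V →L[ℝ] V →L[ℝ] ℝ} (hsymm : ∀ u v, a u v = a v u) (hpos : ∀ u, u ≠ 0 → 0 < a u u)

include hpos in
theorem exists_smul_norm_eq {X w : V} (hX : X ≠ 0) (hw : w ≠ 0) :
    ∃ t : ℝ, t ≠ 0 ∧ a (t • w) (t • w) = a X X := by
  have h1 := hpos w hw
  have h2 : 0 < a X X / a w w := div_pos (hpos X hX) h1
  refine ⟨√(a X X / a w w), (Real.sqrt_pos.2 h2).ne', ?_⟩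
  simp only [map_smul, _root_.smul_apply, smul_eq_mul]
  rw [← mul_assoc, Real.mul_self_sqrt h2.le, div_mul_cancel₀ _ h1.ne']

-- Two linear conditions leave a nonzero vector in dimension above two. With w orthogonal to X and
-- normalised to the length of X, p X + r w with p² + r² = 1 has constant α-length |X| and slope p
-- |X|.
include hpos in
theorem exists_orthogonal_of_two_lt_finrank [FiniteDimensional ℝ V] (hd : 2 < Module.finrank ℝ V)
    {X : V} (hX : X ≠ 0) (u v : V) : ∃ w, a u w = 0 ∧ a v w = 0 ∧ a w w = a X X := by
  have h1 : LinearMap.ker ((a u).toLinearMap.prod (a v).toLinearMap) ≠ ⊥ :=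
    LinearMap.ker_ne_bot_of_finrank_lt (by simpa using hd)
  obtain ⟨w, hw, hw0⟩ := Submodule.exists_mem_ne_zero_of_ne_bot h1
  obtain ⟨t, -, ht⟩ := exists_smul_norm_eq hpos hX hw0
  have hw' := LinearMap.mem_ker.1 hw
  rw [LinearMap.prod_apply, Function.prod, Prod.mk_eq_zero] at hw'
  exact ⟨t • w, by simp [show a u w = 0 from hw'.1], by simp [show a v w = 0 from hw'.2], ht⟩

include hsymm in
theorem norm_circle {X w : V} (hXw : a X w = 0) (hw : a w w = a X X) {p r : ℝ}
    (hpr : p ^ 2 + r ^ 2 = 1) : a (p • X + r • w) (p • X + r • w) = a X X := by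
  simp only [map_add, map_smul, _root_.add_apply, _root_.smul_apply, smul_eq_mul, hXw, hsymm w X,
    hw]
  linear_combination a X X * hpr

include hsymm in
theorem slope_circle {X w : V} (hXw : a X w = 0) (hw : a w w = a X X) {p r : ℝ}
    (hpr : p ^ 2 + r ^ 2 = 1) : betaSlope a X (p • X + r • w) = p * √(a X X) := by
  rw [betaSlope, norm_circle hsymm hXw hw hpr]
  simp only [map_add, map_smul, smul_eq_mul, hXw, mul_zero, add_zero]
  rw [mul_div_assoc, Real.div_sqrt]

include hsymm hpos in
theorem exists_slope_eq {X w : V} (hX : X ≠ 0) (hXw : a X w = 0) (hw : a w w = a X X) {s : ℝ}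
    (hs : s ∈ Set.Icc (-√(a X X)) √(a X X)) :
    ∃ p r : ℝ, p • X + r • w ≠ 0 ∧ betaSlope a X (p • X + r • w) = s := by
  have hb : 0 < √(a X X) := Real.sqrt_pos.2 (hpos X hX)
  have hp : (s / √(a X X)) ^ 2 ≤ 1 := by
    rw [sq_le_one_iff_abs_le_one, abs_div, abs_of_pos hb, div_le_one hb]
    exact abs_le.2 hs
  have hpr : (s / √(a X X)) ^ 2 + (√(1 - (s / √(a X X)) ^ 2)) ^ 2 = 1 := by
    rw [Real.sq_sqrt (by linarith)]; ring
  refine ⟨_, _, fun h0 => ?_, (slope_circle hsymm hXw hw hpr).trans (div_mul_cancel₀ _ hb.ne')⟩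
  have hn := norm_circle hsymm hXw hw hpr
  rw [h0] at hn
  simp at hn
  exact (hpos X hX).ne hn

include hpos in
/-- An alternating form vanishes if it vanishes on orthogonal pairs `(y, z)` with `z` orthogonal
to `X` and `y` equal or orthogonal to `X`. -/
theorem alternating_eq_zero {X : V} (hX : X ≠ 0) {η : V →L[ℝ] V →L[ℝ] ℝ}
    (halt : ∀ u v, η u v = -η v u) (h1 : ∀ z, a X z = 0 → η X z = 0)
    (h2 : ∀ y z, a X y = 0 → a X z = 0 → a y z = 0 → η y z = 0) (u v : V) : η u v = 0 := by
  have hXX := (hpos X hX).ne'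
  have hperp : ∀ u : V, a X (u - (a X u / a X X) • X) = 0 := by
    intro u
    simp only [map_sub, map_smul, smul_eq_mul]
    field_simp
    ring
  have hself : ∀ u, η u u = 0 := fun u => by linarith [halt u u]
  have key : ∀ y z, a X y = 0 → a X z = 0 → η y z = 0 := by
    intro y z hy hz
    by_cases hy0 : y = 0
    · simp [hy0]
    have hyy := (hpos y hy0).ne'
    have h3 := h2 y (z - (a y z / a y y) • y) hy
      (by simp only [map_sub, map_smul, hy, hz]; simp)
      (by simp only [map_sub, map_smul, smul_eq_mul]; field_simp; ring)
    simpa [hself] using h3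
  have h4 := key _ _ (hperp u) (hperp v)
  have h5 := h1 _ (hperp u)
  have h6 := h1 _ (hperp v)
  simp only [map_sub, map_smul, _root_.sub_apply, _root_.smul_apply, smul_eq_mul, hself, mul_zero,
    sub_zero, halt u X] at h4 h5 h6
  rw [h5, h6] at h4
  simpa using h4

include hsymm hpos in
/-- If the spray equation of an `(α, β)`-metric has a quadratic right-hand side, then either the
form `η` (a multiple of `dβ`) vanishes or the profile satisfies an ordinary differential equation
whose solutions are Riemannian. -/
theorem closed_or_profile_eq [FiniteDimensional ℝ V] (hd : 2 < Module.finrank ℝ V)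
    {X : V} (hX : X ≠ 0) {ψ₁ q : ℝ → ℝ} (hψ₁ : ContinuousAt ψ₁ 0) (hq : ContinuousAt q 0)
    (hq0 : ∀ s ∈ Set.Icc (-√(a X X)) √(a X X), q s ≠ 0)
    {η : V →L[ℝ] V →L[ℝ] ℝ} (halt : ∀ u v, η u v = -η v u) {κ : V → V → ℝ}
    (hκ : ∀ u w z, ∃ k₁ k₂ k₃ : ℝ, ∀ p r : ℝ,
      κ (p • u + r • w) z = p ^ 2 * k₁ + p * r * k₂ + r ^ 2 * k₃)
    (h : ∀ y v, y ≠ 0 → a y v = 0 → a X v = 0 →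
      √(a y y) * ψ₁ (betaSlope a X y) * η y v = q (betaSlope a X y) * κ y v) :
    (∀ u v, η u v = 0) ∨
      ∃ k : ℝ, ∀ s ∈ Set.Ioo (-√(a X X)) √(a X X), ψ₁ s = k * s * q s := by
  have hXX := hpos X hX
  set b := √(a X X) with hb
  have hb0 : 0 < b := Real.sqrt_pos.2 hXX
  -- On the circle p X + r w the form η(·, z) is linear and κ(·, z) quadratic in (p, r). Division by
  -- q leads to `exists_linear_of_circle` with Q(p) = b ψ'(p b)/q(p b).
  have main : ∀ w z, a X w = 0 → a w w = a X X → a X z = 0 → a w z = 0 →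
      (η X z ≠ 0 ∨ η w z ≠ 0) →
      ∃ k : ℝ, ∀ s ∈ Set.Ioo (-b) b, ψ₁ s = k * s * q s := by
    intro w z hXw hw hXz hwz hne
    obtain ⟨k₁, k₂, k₃, hk⟩ := hκ X w z
    have hcont : ContinuousAt (fun p : ℝ => b * ψ₁ (p * b) / q (p * b)) 0 := by
      have h0 : (0 : ℝ) * b = 0 := zero_mul b
      have hm : ContinuousAt (fun p : ℝ => p * b) 0 := by fun_prop
      have hc1 : ContinuousAt (fun p : ℝ => ψ₁ (p * b)) 0 :=
        ContinuousAt.comp (g := ψ₁) (by rwa [h0]) hm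
      have hc2 : ContinuousAt (fun p : ℝ => q (p * b)) 0 :=
        ContinuousAt.comp (g := q) (by rwa [h0]) hm
      exact (continuousAt_const.mul hc1).div hc2 (by rw [h0]; exact hq0 0 ⟨by linarith, hb0.le⟩)
    have hcirc : ∀ p r : ℝ, p ^ 2 + r ^ 2 = 1 → b * ψ₁ (p * b) / q (p * b) *
        (p * η X z + r * η w z) = p ^ 2 * k₁ + p * r * k₂ + r ^ 2 * k₃ := by
      intro p r hpr
      have hn := norm_circle hsymm hXw hw hpr
      have hy0 : p • X + r • w ≠ 0 := by
        intro h0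
        rw [h0] at hn
        simp at hn
        exact hXX.ne hn
      have h1 := h (p • X + r • w) z hy0 (by simp [hXz, hwz]) hXz
      rw [hn, slope_circle hsymm hXw hw hpr, hk, ← hb] at h1
      have hp : p ^ 2 ≤ 1 := by nlinarith [sq_nonneg r]
      have h2 := hq0 (p * b) (by
        have := abs_le.1 ((sq_le_one_iff_abs_le_one p).1 hp)
        constructor <;> nlinarith [this.1, this.2])
      simp only [map_add, map_smul, _root_.add_apply, _root_.smul_apply, smul_eq_mul] at h1
      rw [div_mul_eq_mul_div, div_eq_iff h2]
      linarith
    obtain ⟨k, hk'⟩ := exists_linear_of_circle hcont hcirc hne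
    refine ⟨k / b ^ 2, fun s hs => ?_⟩
    have h1 := hk' (s / b) ⟨by rw [lt_div_iff₀ hb0]; linarith [hs.1],
      by rw [div_lt_iff₀ hb0]; linarith [hs.2]⟩
    have h2 := hq0 s ⟨hs.1.le, hs.2.le⟩
    rw [div_mul_cancel₀ _ hb0.ne', div_eq_iff h2] at h1
    field_simp at h1 ⊢
    linarith
  by_contra! hcon
  obtain ⟨⟨u, v, huv⟩, hk⟩ := hcon
  refine huv (alternating_eq_zero hpos hX halt (fun z hz => ?_)
    (fun y z hy hz hyz => ?_) u v)
  -- For η(X, z) any w orthogonal to X and z closes up the circle; for η(y, z) below, w is y itself,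
  -- rescaled.
  · by_contra hne
    obtain ⟨w, hw1, hw2, hw3⟩ := exists_orthogonal_of_two_lt_finrank hpos hd hX X z
    obtain ⟨k, hk'⟩ := main w z hw1 hw3 hz (by rw [hsymm]; exact hw2) (Or.inl hne)
    obtain ⟨s, hs, hs'⟩ := hk k
    exact hs' (hk' s hs)
  · by_contra hne
    have hy0 : y ≠ 0 := by
      rintro rfl
      simp at hne
    obtain ⟨t, ht, ht'⟩ := exists_smul_norm_eq hpos hX hy0
    obtain ⟨k, hk'⟩ := main (t • y) z (by simp [hy]) ht' hz (by simp [hyz])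
      (Or.inr (by simpa [ht] using hne))
    obtain ⟨s, hs, hs'⟩ := hk k
    exact hs' (hk' s hs)

end Rigidity

/-! ### The cyclic sum and the algebraic condition -/

section Core

open Filter Topology

variable {V : Type*} [NormedAddCommGroup V] [NormedSpace ℝ V]
  {a : V →L[ℝ] V →L[ℝ] ℝ} (hsymm : ∀ u v, a u v = a v u) (hpos : ∀ u, u ≠ 0 → 0 < a u u)

/-- The cyclic sum of the second derivative of `α² ψ(β/α)` at `y`. -/
def cyclicSum (a : V →L[ℝ] V →L[ℝ] ℝ) (X : V) (ψ ψ₁ ψ₂ : ℝ → ℝ) (br : V →L[ℝ] V →L[ℝ] V)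
    (x y z : V) : ℝ :=
  secondDeriv a X ψ ψ₁ ψ₂ y (br x y) z + secondDeriv a X ψ ψ₁ ψ₂ y (br y z) x +
    secondDeriv a X ψ ψ₁ ψ₂ y (br z x) y

/-- The difference of the two sides of the algebraic condition for cyclicity. -/
def cyclicDefect (a : V →L[ℝ] V →L[ℝ] ℝ) (X : V) (br : V →L[ℝ] V →L[ℝ] V) (u v y : V) : ℝ :=
  a (br y u) y * (a y y * a X v - a X y * a v y) - a (br y v) y * (a y y * a X u - a X y * a u y)

variable {X : V} {ψ ψ₁ ψ₂ ψ₃ : ℝ → ℝ} {br : V →L[ℝ] V →L[ℝ] V}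

-- The multiples of a cancel by cyclicity and a(X, ·) vanishes on brackets. What remains carries the
-- factor ψ' - s ψ''; in the summand paired with y itself even that part vanishes, as a(X, y) = s
-- α(y).
include hsymm hpos in
theorem cyclicSum_eq_of_closed (halt : ∀ u v, br u v = -br v u)
    (hclosed : ∀ u v, a X (br u v) = 0)
    (hcyc : ∀ x y z, a (br x y) z + a (br y z) x + a (br z x) y = 0) {y : V} (hy : y ≠ 0)
    (x z : V) :
    cyclicSum a X ψ ψ₁ ψ₂ br x y z =
      (ψ₁ (betaSlope a X y) - betaSlope a X y * ψ₂ (betaSlope a X y)) / (a y y * √(a y y)) *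
        cyclicDefect a X br z x y := by
  have h1 := hpos y hy
  have h2 := Real.sqrt_pos.2 h1
  have hs : betaSlope a X y * √(a y y) = a X y := div_mul_cancel₀ _ h2.ne'
  obtain ⟨n, hn, hn2⟩ : ∃ n, n = √(a y y) ∧ a y y = n ^ 2 :=
    ⟨_, rfl, (Real.sq_sqrt h1.le).symm⟩
  have e1 : a y (br x y) = -a (br y x) y := by rw [halt x y, map_neg, hsymm]
  have e2 : a (br x y) z = -a (br y z) x - a (br z x) y := by linarith [hcyc x y z]
  simp only [cyclicSum, cyclicDefect, secondDeriv, hclosed, e1, e2, hsymm y (br y z),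
    hsymm y (br z x), hsymm y z, hsymm y x]
  rw [← hs]
  rw [← hn] at h2 ⊢
  rw [hn2]
  field_simp
  ring

theorem apply_self_eq_zero_of_alternating (halt : ∀ u v, br u v = -br v u) (u : V) :
    br u u = 0 := by
  have h : (2 : ℝ) • br u u = 0 := by
    rw [two_smul]
    nth_rewrite 1 [halt u u]
    exact neg_add_cancel _
  exact (smul_eq_zero.1 h).resolve_left two_ne_zero

/-- By linearity in x it suffices to take x = z or x = y; then one bracket is zero and the other two
are opposite. -/
theorem cyclicSum_eq_zero_of_eq_smul_add_smul (hsymm : ∀ u v, a u v = a v u)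
    (halt : ∀ u v, br u v = -br v u) {x y z : V} {p q : ℝ}
    (h : x = p • z + q • y) : cyclicSum a X ψ ψ₁ ψ₂ br x y z = 0 := by
  have hself := apply_self_eq_zero_of_alternating halt
  subst h
  simp only [cyclicSum, secondDeriv, map_add, map_smul, _root_.add_apply, _root_.smul_apply,
    smul_eq_mul, hself, smul_zero, add_zero, zero_add, halt y z, map_neg, _root_.neg_apply,
    hsymm y z]
  ring

theorem cyclicDefect_eq_zero_of_eq_smul_add_smul
    (halt : ∀ u v, br u v = -br v u) {u v y : V} {p q : ℝ}
    (h : u = p • v + q • y) : cyclicDefect a X br u v y = 0 := by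
  have hself := apply_self_eq_zero_of_alternating halt
  subst h
  simp only [cyclicDefect, map_add, map_smul, _root_.add_apply, _root_.smul_apply,
    smul_eq_mul, hself, smul_zero, add_zero]
  ring

theorem cyclicSum_swap (halt : ∀ u v, br u v = -br v u)
    (x y z : V) : cyclicSum a X ψ ψ₁ ψ₂ br z y x = -cyclicSum a X ψ ψ₁ ψ₂ br x y z := by
  simp only [cyclicSum, secondDeriv, halt z y, halt y x, halt x z, map_neg, _root_.neg_apply]
  ring

theorem cyclicDefect_swap (u v y : V) :
    cyclicDefect a X br v u y = -cyclicDefect a X br u v y := by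
  simp only [cyclicDefect]
  ring

/-- In a dependence relation among u, v, y the coefficient of u or of v is nonzero, since y ≠ 0. -/
theorem exists_eq_smul_add_smul_of_finrank_le_two [FiniteDimensional ℝ V]
    (hd : Module.finrank ℝ V ≤ 2) {y : V} (hy : y ≠ 0) (u v : V) :
    (∃ p q : ℝ, u = p • v + q • y) ∨ ∃ p q : ℝ, v = p • u + q • y := by
  have h1 : ¬ LinearIndependent ℝ ![u, v, y] := fun h => by
    have := h.fintype_card_le_finrank
    simp at this
    omega
  obtain ⟨g, hg, i, hi⟩ := Fintype.not_linearIndependent_iff.1 h1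
  simp only [Fin.sum_univ_three, Matrix.cons_val_zero, Matrix.cons_val_one, Matrix.cons_val] at hg
  by_cases h0 : g 0 = 0
  · by_cases h1 : g 1 = 0
    · have h2 : g 2 ≠ 0 := by
        intro h2
        fin_cases i <;> simp_all
      rw [h0, h1, zero_smul, zero_smul, zero_add, zero_add] at hg
      exact absurd ((smul_eq_zero.1 hg).resolve_left h2) hy
    · refine Or.inr ⟨-(g 0 / g 1), -(g 2 / g 1), ?_⟩
      have : g 1 • v = -(g 0 • u) - g 2 • y := by
        rw [← sub_eq_zero, ← hg]; abel
      rw [← inv_smul_smul₀ h1 v, this]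
      module
  · refine Or.inl ⟨-(g 1 / g 0), -(g 2 / g 0), ?_⟩
    have : g 0 • u = -(g 1 • v) - g 2 • y := by
      rw [← sub_eq_zero, ← hg]; abel
    rw [← inv_smul_smul₀ h0 u, this]
    module

/-- The defect vanishes everywhere if it vanishes near one point on each line through it. -/
theorem cyclicDefect_eq_zero_of_eventually {u v y y₀ : V}
    (h : ∀ᶠ t : ℝ in 𝓝 0, cyclicDefect a X br u v (y₀ + t • (y - y₀)) = 0) :
    cyclicDefect a X br u v y = 0 := by
  -- Along a line the defect is polynomial in t, so the identity theorem carries its vanishing near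
  -- t = 0 to t = 1.
  have han : AnalyticOnNhd ℝ (fun t : ℝ => cyclicDefect a X br u v (y₀ + t • (y - y₀))) Set.univ := by
    intro t _
    simp only [cyclicDefect, map_add, map_smul, _root_.add_apply, _root_.smul_apply, smul_eq_mul]
    fun_prop
  have := han.eqOn_zero_of_preconnected_of_eventuallyEq_zero isPreconnected_univ (Set.mem_univ 0) h
    (Set.mem_univ 1)
  simpa using this

variable {b₀ : ℝ}

include hsymm hpos in
/-- In a closed situation, cyclicity of an `(α, β)`-norm which is not Euclidean is equivalent to
the algebraic condition. -/
theorem cyclicSum_iff_of_closed [FiniteDimensional ℝ V] (hd : 2 < Module.finrank ℝ V) (hX : X ≠ 0)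
    (hb₀ : √(a X X) < b₀)
    (hψ : ∀ s ∈ Set.Ioo (-b₀) b₀, HasDerivAt ψ (ψ₁ s) s)
    (hψ₁ : ∀ s ∈ Set.Ioo (-b₀) b₀, HasDerivAt ψ₁ (ψ₂ s) s)
    (hψ₂ : ∀ s ∈ Set.Ioo (-b₀) b₀, HasDerivAt ψ₂ (ψ₃ s) s)
    (hnon : ¬ ∃ A C : ℝ, ∀ s ∈ Set.Icc (-√(a X X)) √(a X X), ψ s = A + C * s ^ 2)
    (halt : ∀ u v, br u v = -br v u)
    (hclosed : ∀ u v, a X (br u v) = 0)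
    (hcyc : ∀ x y z, a (br x y) z + a (br y z) x + a (br z x) y = 0) :
    (∀ x y z, y ≠ 0 → cyclicSum a X ψ ψ₁ ψ₂ br x y z = 0) ↔
      ∀ u v y, cyclicDefect a X br u v y = 0 := by
  constructor
  · intro h u v y
    have hb : 0 < √(a X X) := Real.sqrt_pos.2 (hpos X hX)
    -- Such a slope s exists because the profile is not A + C s². It is realised by some y₀, near
    -- which the factor in front of the defect stays nonzero.
    obtain ⟨s, hs, hs0⟩ : ∃ s ∈ Set.Ioo (-√(a X X)) √(a X X), ψ₁ s - s * ψ₂ s ≠ 0 := by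
      by_contra! hcon
      exact hnon (exists_quadratic_of_deriv_eq_mul_deriv hb₀ hψ hψ₁ hψ₂ hcon)
    obtain ⟨w, hw, -, hww⟩ := exists_orthogonal_of_two_lt_finrank hpos hd hX X X
    obtain ⟨p, r, hn, hsl⟩ :=
      exists_slope_eq hsymm hpos hX hw hww (Set.Ioo_subset_Icc_self hs)
    set y₀ := p • X + r • w with hy₀
    refine cyclicDefect_eq_zero_of_eventually (y₀ := y₀) ?_
    have hsI := Icc_subset_Ioo_neg hb₀ (Set.Ioo_subset_Icc_self hs)
    have hc1 : ContinuousAt (fun t : ℝ => betaSlope a X (y₀ + t • (y - y₀))) 0 :=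
      (hasDerivAt_slope hsymm hpos X (hasDerivAt_add_smul y₀ (y - y₀) 0)
        (by simpa using hn)).continuousAt
    have hc2 : ContinuousAt (fun s => ψ₁ s - s * ψ₂ s) s :=
      (hψ₁ s hsI).continuousAt.sub (continuousAt_id.mul (hψ₂ s hsI).continuousAt)
    have hc3 := ContinuousAt.comp (g := fun s => ψ₁ s - s * ψ₂ s) (x := (0 : ℝ))
      (f := fun t : ℝ => betaSlope a X (y₀ + t • (y - y₀))) (by simpa [hsl] using hc2) hc1
    filter_upwards [hc3.eventually_ne (y := 0) (by simpa [hsl] using hs0),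
      eventually_add_smul_ne_zero hn (y - y₀)] with t ht ht0
    have h1 := h v (y₀ + t • (y - y₀)) u ht0
    rw [cyclicSum_eq_of_closed hsymm hpos halt hclosed hcyc ht0] at h1
    have h2 := hpos _ ht0
    exact (mul_eq_zero.1 h1).resolve_left
      (div_ne_zero ht (mul_pos h2 (Real.sqrt_pos.2 h2)).ne')
  · intro h x y z hy
    rw [cyclicSum_eq_of_closed hsymm hpos halt hclosed hcyc hy, h, mul_zero]

-- The conclusion is dβ = 0 at the base point, as B' antisymmetrised is the exterior derivative of
-- the coframe. The alternative in `closed_or_profile_eq` is excluded by the non-quadratic profile.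
include hsymm hpos in
theorem closed_of_spray [FiniteDimensional ℝ V] (hd : 2 < Module.finrank ℝ V) (hX : X ≠ 0)
    (hb₀ : √(a X X) < b₀) (hψpos : ∀ s ∈ Set.Ioo (-b₀) b₀, 0 < ψ s)
    (hψ : ∀ s ∈ Set.Ioo (-b₀) b₀, HasDerivAt ψ (ψ₁ s) s)
    (hψ₁ : ∀ s ∈ Set.Ioo (-b₀) b₀, HasDerivAt ψ₁ (ψ₂ s) s)
    (hnon : ¬ ∃ A C : ℝ, ∀ s ∈ Set.Icc (-√(a X X)) √(a X X), ψ s = A + C * s ^ 2)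
    {f : V → ℝ} (hf : ∀ y, f y ^ 2 = a y y * ψ (betaSlope a X y))
    (hfpos : ∀ y u, y ≠ 0 → u ≠ 0 → 0 < fundamentalTensor f y u u)
    {F : V → V → ℝ} {x₀ : V} {B : V → V →L[ℝ] V} {B' : V →L[ℝ] V →L[ℝ] V}
    (hB : HasFDerivAt B B' x₀) (hB0 : B x₀ = ContinuousLinearMap.id ℝ V)
    (hF : ∀ᶠ x in 𝓝 x₀, ∀ w, F x w = f (B x w))
    {Γ : V →ₗ[ℝ] V →ₗ[ℝ] V} {P : V → ℝ}
    (hspray : ∀ y, y ≠ 0 → IsSprayCoefficient F x₀ y ((1 / 2 : ℝ) • Γ y y + P y • y)) (u v : V) :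
    a X (B' u v - B' v u) = 0 := by
  have hb : 0 < √(a X X) := Real.sqrt_pos.2 (hpos X hX)
  have h0 : (0 : ℝ) ∈ Set.Ioo (-b₀) b₀ := ⟨by linarith, by linarith⟩
  obtain ⟨η, hη⟩ : ∃ η : V →L[ℝ] V →L[ℝ] ℝ, ∀ u v, η u v = a X (B' u v - B' v u) :=
    ⟨(ContinuousLinearMap.compL ℝ V V ℝ (a X)).comp (B' - B'.flip), fun u v => by simp⟩
  rw [← hη]
  refine (closed_or_profile_eq hsymm hpos hd hX (ψ₁ := ψ₁) (q := fun s => 2 * ψ s - s * ψ₁ s)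
    (hψ₁ 0 h0).continuousAt ?_ ?_ (η := η) ?_ (κ := fun y v => a (Γ y y) v - a (B' y y) v -
      a y (B' y v - B' v y)) ?_ ?_).resolve_right ?_ u v
  · exact (continuousAt_const.mul (hψ 0 h0).continuousAt).sub
      (continuousAt_id.mul (hψ₁ 0 h0).continuousAt)
  -- For v orthogonal to y₀ and X with a(v, v) = a(X, X), the fundamental tensor gives ½ (2ψ - s ψ')
  -- a(X, X) on (v, v), and this is positive.
  · intro s hs
    obtain ⟨w, hw, -, hww⟩ := exists_orthogonal_of_two_lt_finrank hpos hd hX X X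
    obtain ⟨p, r, hn, hsl⟩ := exists_slope_eq hsymm hpos hX hw hww hs
    set y₀ := p • X + r • w with hy₀
    obtain ⟨v, hv1, hv2, hv3⟩ := exists_orthogonal_of_two_lt_finrank hpos hd hX X w
    have hv0 : v ≠ 0 := by
      rintro rfl
      simp at hv3
      exact (hpos X hX).ne hv3
    have h1 := hfpos y₀ v hn hv0
    have h2 : a y₀ v = 0 := by simp [hy₀, hv1, hv2]
    rw [fundamentalTensor_eq_secondDeriv hsymm hpos hb₀ hψ hψ₁ hf hn, secondDeriv, hsl, h2, hv1,
      hv3] at h1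
    intro hcon
    rw [hcon] at h1
    simp at h1
  · intro u v
    rw [hη, hη, ← map_neg, neg_sub]
  · intro u w z
    refine ⟨a (Γ u u) z - a (B' u u) z - a u (B' u z - B' z u),
      a (Γ u w) z + a (Γ w u) z - a (B' u w) z - a (B' w u) z - a u (B' w z - B' z w) -
        a w (B' u z - B' z u),
      a (Γ w w) z - a (B' w w) z - a w (B' w z - B' z w), fun p r => ?_⟩
    simp only [map_add, map_smul, map_sub, _root_.add_apply, _root_.smul_apply, 
      LinearMap.add_apply, LinearMap.smul_apply, smul_eq_mul]
    ring
  -- The projective term P(y) y pairs to zero with v, so only the part quadratic in y remains.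
  · intro y v hy hyv hXv
    have h1 := spray_eq_of_coframe hsymm hpos hb₀ hψ hψ₁ hf hB hB0 hF hy (hspray y hy) hyv hXv
    rw [hη, h1]
    simp only [map_add, map_smul, _root_.add_apply, _root_.smul_apply, smul_eq_mul, hyv]
    ring
  · rintro ⟨k, hk⟩
    exact hnon (exists_quadratic_of_deriv_eq hb hb₀ hψpos hψ hψ₁ hk)

end Core

/-! ### Transport between `𝔪` and the tangent spaces of `G/H` -/

section Assembly

open Filter Topology

theorem fundamentalTensor_comp_linearMap {V W : Type*} [AddCommGroup V] [Module ℝ V]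
    [AddCommGroup W] [Module ℝ W] (F : W → ℝ) (L : V →ₗ[ℝ] W) (y u v : V) :
    fundamentalTensor (fun x => F (L x)) y u v = fundamentalTensor F (L y) (L u) (L v) := by
  simp only [fundamentalTensor, map_add, map_smul]

theorem hasDerivAt_deriv_of_contDiffOn {g : ℝ → ℝ} {s : Set ℝ} (hs : IsOpen s)
    (hg : ContDiffOn ℝ ∞ g s) {x : ℝ} (hx : x ∈ s) : HasDerivAt g (deriv g x) x :=
  ((hg.contDiffAt (hs.mem_nhds hx)).differentiableAt (by simp)).hasDerivAt

variable {E : Type*} [NormedAddCommGroup E] [NormedSpace ℝ E]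
  {G : Type*} [TopologicalSpace G] [Group G] [ChartedSpace E G]
  {E' : Type*} [NormedAddCommGroup E'] [NormedSpace ℝ E']
  {H : Subgroup G} [ChartedSpace E' (G ⧸ H)]

theorem projDeriv_injective_on (D : ReductiveDecomposition E E' H) {x : D.m}
    (hx : projDeriv (E' := E') H (x : GroupLieAlgebra 𝓘(ℝ, E) G) = 0) : x = 0 := by
  have h1 : (x : GroupLieAlgebra 𝓘(ℝ, E) G) ∈ D.m ⊓ isotropyAlgebra E' H :=
    ⟨x.2, LinearMap.mem_ker.2 hx⟩
  rw [D.isCompl.inf_eq_bot, Submodule.mem_bot] at h1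
  exact Subtype.ext h1

theorem exists_projDeriv_section [FiniteDimensional ℝ E'] (D : ReductiveDecomposition E E' H)
    (L : E' ≃ₗ[ℝ] D.m) :
    ∃ σ : E' →ₗ[ℝ] D.m, ∀ w, projDeriv (E' := E') H (σ w : GroupLieAlgebra 𝓘(ℝ, E) G) = w := by
  -- dπ ∘ `L` is an injective endomorphism of a finite-dimensional space, hence invertible; its
  -- inverse gives the section.
  set T : E' →ₗ[ℝ] E' := (projDeriv (E' := E') (E := E) H ∘ₗ D.m.subtype) ∘ₗ L.toLinearMap with hT
  have hinj : Function.Injective T := by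
    rw [injective_iff_map_eq_zero]
    intro w hw
    exact L.map_eq_zero_iff.1 (projDeriv_injective_on D hw)
  refine ⟨L.toLinearMap ∘ₗ (LinearEquiv.ofInjectiveEndo T hinj).symm.toLinearMap, fun w => ?_⟩
  exact (LinearEquiv.ofInjectiveEndo T hinj).apply_symm_apply w

/-- An invariant metric is Riemannian if the square of its restriction to `𝔪` is a quadratic
form. -/
theorem isRiemannian_of_normOn_sq (D : ReductiveDecomposition E E' H)
    {F : (p : G ⧸ H) → TangentSpace 𝓘(ℝ, E') p → ℝ} (hFinv : IsInvariantMetric F)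
    (σ : E' →ₗ[ℝ] D.m)
    (hσ : ∀ w, projDeriv (E' := E') H (σ w : GroupLieAlgebra 𝓘(ℝ, E) G) = w)
    (Q : D.m →ₗ[ℝ] D.m →ₗ[ℝ] ℝ) (hQ : ∀ u v, Q u v = Q v u)
    (h : ∀ y, D.normOn F y ^ 2 = Q y y) : IsRiemannian F := by
  intro p
  induction p using QuotientGroup.induction_on with
  | H g =>
    -- The differential of translation by g⁻¹ identifies the tangent space at gH with that at the
    -- origin, where the quadratic form is pulled back from `𝔪`.
    obtain ⟨d, hd⟩ : ∃ d : E' →ₗ[ℝ] E', ∀ v : E', F (g : G ⧸ H) v = F ((1 : G) : G ⧸ H) (d v) := by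
      refine ⟨(mfderiv 𝓘(ℝ, E') 𝓘(ℝ, E') (fun q : G ⧸ H => g⁻¹ • q) (g : G ⧸ H)).toLinearMap,
        fun v => ?_⟩
      rw [← hFinv g⁻¹ (g : G ⧸ H) v]
      refine apply_congr_of_eq F ?_ rfl
      change ((g⁻¹ * g : G) : G ⧸ H) = ((1 : G) : G ⧸ H)
      rw [inv_mul_cancel]
    refine ⟨Q.compl₁₂ (σ ∘ₗ d) (σ ∘ₗ d), fun u v => hQ _ _, fun v => ?_⟩
    have h1 := h (σ (d v))
    rw [ReductiveDecomposition.normOn, hσ] at h1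
    exact (congrArg (· ^ 2) (hd v)).trans h1

end Assembly

end CyclicFinsler

end

/-! ### The characterisation of cyclic metrics -/

open CyclicFinsler in
theorem theorem1p4
    {E : Type*} [NormedAddCommGroup E] [NormedSpace ℝ E] [FiniteDimensional ℝ E]
    {G : Type*} [TopologicalSpace G] [Group G] [ChartedSpace E G] [LieGroup 𝓘(ℝ, E) ∞ G]
    {E' : Type*} [NormedAddCommGroup E'] [NormedSpace ℝ E'] [FiniteDimensional ℝ E']
    -- the homogeneous manifold `G/H`
    (H : Subgroup G) (hH : IsClosed (H : Set G))
    [ChartedSpace E' (G ⧸ H)] [IsManifold 𝓘(ℝ, E') ∞ (G ⧸ H)]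
    (hπ : Manifold.IsSubmersion 𝓘(ℝ, E) 𝓘(ℝ, E') ∞ (fun a : G => (a : G ⧸ H)))
    -- a reductive decomposition, an invariant inner product, an invariant nonzero vector
    (D : CyclicFinsler.ReductiveDecomposition E E' H)
    (α : D.m →ₗ[ℝ] D.m →ₗ[ℝ] ℝ) (hα : D.IsInvariantInner α)
    (X : D.m) (hX : X ≠ 0) (hXinv : ∀ h : H, D.adOn h X = X)
    -- the profile function `φ`, positive and smooth on `(-b₀, b₀)` where `b₀ > |X|`
    (φ : ℝ → ℝ) (b₀ : ℝ) (hb₀ : Real.sqrt (α X X) < b₀)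
    (hφ : ContDiffOn ℝ ∞ φ (Set.Ioo (-b₀) b₀)) (hφpos : ∀ r ∈ Set.Ioo (-b₀) b₀, 0 < φ r)
    -- the homogeneous Finsler metric on `G/H` which on `𝔪` is the norm `α φ(β/α)`
    (F : (p : G ⧸ H) → TangentSpace 𝓘(ℝ, E') p → ℝ)
    (hF : CyclicFinsler.IsFinslerMetric F) (hFinv : CyclicFinsler.IsInvariantMetric F)
    (hFφ : ∀ y : D.m,
      D.normOn F y = Real.sqrt (α y y) * φ (α X y / Real.sqrt (α y y)))
    (hcyc : D.IsCyclicInner α)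
    (hnonRiem : ¬ CyclicFinsler.IsRiemannian F) (hDouglas : CyclicFinsler.IsDouglas F) :
    D.IsCyclic F ↔
      ∀ u v y : D.m,
        α (D.bracket y u) y * (α y y * α X v - α X y * α v y) =
          α (D.bracket y v) y * (α y y * α X u - α X y * α u y) := by
  obtain ⟨e, he, x₀, hx₀, L, B, B', hB, hB0, hFB, hbr⟩ := exists_chart_coframe hπ D hFinv
  -- transport the data to the model space
  obtain ⟨a, ha⟩ : ∃ a : E' →L[ℝ] E' →L[ℝ] ℝ, ∀ u v, a u v = α (L u) (L v) :=
    ⟨LinearMap.toContinuousLinearMap ((LinearMap.toContinuousLinearMap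
      (𝕜 := ℝ) (E := E') (F' := ℝ)).toLinearMap ∘ₗ α.compl₁₂ L.toLinearMap L.toLinearMap),
      fun _ _ => rfl⟩
  obtain ⟨X', rfl⟩ := L.surjective X
  have hX' : X' ≠ 0 := fun h => hX (by simp [h])
  obtain ⟨br, hbrB, hbrD⟩ : ∃ br : E' →L[ℝ] E' →L[ℝ] E', (∀ u v, br u v = -(B' u v - B' v u)) ∧
      ∀ u v, L (br u v) = D.bracket (L u) (L v) :=
    ⟨B'.flip - B', fun u v => by simp, fun u v => by
      have := hbr u v
      rw [← neg_eq_iff_eq_neg, ← map_neg] at this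
      rw [← this]
      simp⟩
  have hsymm : ∀ u v, a u v = a v u := fun u v => by rw [ha, ha, hα.symm]
  have hpos : ∀ u, u ≠ 0 → 0 < a u u := fun u hu => by
    rw [ha]
    exact hα.posDef _ (fun h => hu (L.map_eq_zero_iff.1 h))
  have halt : ∀ u v, br u v = -br v u := fun u v => by rw [hbrB, hbrB]; abel
  have hcyc' : ∀ x y z, a (br x y) z + a (br y z) x + a (br z x) y = 0 := fun x y z => by
    simp only [ha, hbrD]
    exact hcyc _ _ _
  have hb₀' : √(a X' X') < b₀ := by rwa [ha]
  have hopen : IsOpen (Set.Ioo (-b₀) b₀) := isOpen_Ioo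
  set ψ : ℝ → ℝ := fun s => φ s ^ 2 with hψdef
  have hψc : ContDiffOn ℝ ∞ ψ (Set.Ioo (-b₀) b₀) := hφ.pow 2
  have hψc₁ := hψc.deriv_of_isOpen (m := ∞) hopen (by simp)
  have hψc₂ := hψc₁.deriv_of_isOpen (m := ∞) hopen (by simp)
  have hψ := fun s (hs : s ∈ Set.Ioo (-b₀) b₀) => hasDerivAt_deriv_of_contDiffOn hopen hψc hs
  have hψ₁ := fun s (hs : s ∈ Set.Ioo (-b₀) b₀) => hasDerivAt_deriv_of_contDiffOn hopen hψc₁ hs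
  have hψ₂ := fun s (hs : s ∈ Set.Ioo (-b₀) b₀) => hasDerivAt_deriv_of_contDiffOn hopen hψc₂ hs
  have hψpos : ∀ s ∈ Set.Ioo (-b₀) b₀, 0 < ψ s := fun s hs => pow_pos (hφpos s hs) 2
  have hf : ∀ y, D.normOn F (L y) ^ 2 = a y y * ψ (betaSlope a X' y) := by
    intro y
    have hnn : 0 ≤ a y y := by
      by_cases hy : y = 0
      · simp [hy]
      · exact (hpos y hy).le
    rw [hFφ, ← ha, ← ha, mul_pow, Real.sq_sqrt hnn, betaSlope]
  have hfund : ∀ y u v, fundamentalTensor (D.normOn F) (L y) (L u) (L v) =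
      fundamentalTensor (fun y => D.normOn F (L y)) y u v := fun y u v =>
    (fundamentalTensor_comp_linearMap (D.normOn F) L.toLinearMap y u v).symm
  -- both sides in the model space
  have hleft : D.IsCyclic F ↔ ∀ x y z, y ≠ 0 →
      cyclicSum a X' ψ (deriv ψ) (deriv (deriv ψ)) br x y z = 0 := by
    have key : ∀ x y z, y ≠ 0 →
        fundamentalTensor (D.normOn F) (L y) (D.bracket (L x) (L y)) (L z) +
          fundamentalTensor (D.normOn F) (L y) (D.bracket (L y) (L z)) (L x) +
          fundamentalTensor (D.normOn F) (L y) (D.bracket (L z) (L x)) (L y) =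
        1 / 2 * cyclicSum a X' ψ (deriv ψ) (deriv (deriv ψ)) br x y z := by
      intro x y z hy
      simp only [← hbrD, hfund, cyclicSum,
        fundamentalTensor_eq_secondDeriv hsymm hpos hb₀' hψ hψ₁ hf hy]
      ring
    constructor
    · intro h x y z hy
      have h1 := h (L x) (L y) (L z) (fun h0 => hy (L.map_eq_zero_iff.1 h0))
      rw [key x y z hy] at h1
      linarith
    · intro h x y z hy
      obtain ⟨x, rfl⟩ := L.surjective x
      obtain ⟨y, rfl⟩ := L.surjective y
      obtain ⟨z, rfl⟩ := L.surjective z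
      have hy' : y ≠ 0 := fun h0 => hy (by simp [h0])
      rw [key x y z hy', h x y z hy', mul_zero]
  have hright : (∀ u v y : D.m,
        α (D.bracket y u) y * (α y y * α (L X') v - α (L X') y * α v y) =
          α (D.bracket y v) y * (α y y * α (L X') u - α (L X') y * α u y)) ↔
      ∀ u v y, cyclicDefect a X' br u v y = 0 := by
    simp only [cyclicDefect, ha, hbrD]
    exact ⟨fun h u v y => sub_eq_zero.2 (h _ _ _), fun h u v y => sub_eq_zero.1 <| by
      simpa using h (L.symm u) (L.symm v) (L.symm y)⟩
  rw [hleft, hright]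
  -- The spray argument needs vectors orthogonal to two given ones; in dimension at most two both
  -- sides hold by linear dependence.
  rcases Nat.lt_or_ge 2 (Module.finrank ℝ E') with hd | hd
  · obtain ⟨σ, hσ⟩ := exists_projDeriv_section D L
    have hnon : ¬ ∃ A C : ℝ, ∀ s ∈ Set.Icc (-√(a X' X')) √(a X' X'), ψ s = A + C * s ^ 2 := by
      rintro ⟨A, C, hAC⟩
      -- The profile A + C s² makes F² the quadratic form A α² + C β².
      refine hnonRiem (isRiemannian_of_normOn_sq D hFinv σ hσ
        (A • α + C • (LinearMap.mul ℝ ℝ).compl₁₂ (α (L X')) (α (L X'))) (fun u v => ?_)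
        (fun y => ?_))
      · simp [hα.symm u v, mul_comm]
      · obtain ⟨y, rfl⟩ := L.surjective y
        rw [hf, hAC _ (abs_le.1 (abs_slope_le hsymm hpos X' y))]
        simp only [LinearMap.add_apply, LinearMap.smul_apply, LinearMap.compl₁₂_apply,
          LinearMap.mul_apply', smul_eq_mul, ← ha]
        by_cases hy : y = 0
        · simp [hy]
        · have h1 := hpos y hy
          rw [betaSlope, div_pow, Real.sq_sqrt h1.le]
          field_simp
    have hfpos : ∀ y u, y ≠ 0 → u ≠ 0 →
        0 < fundamentalTensor (fun y => D.normOn F (L y)) y u u := by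
      intro y u hy hu
      have hne : ∀ w, w ≠ 0 →
          projDeriv (E' := E') H (L w : GroupLieAlgebra 𝓘(ℝ, E) G) ≠ 0 :=
        fun w hw h0 => hw (L.map_eq_zero_iff.1 (projDeriv_injective_on D h0))
      have h1 := hF.posDef ((1 : G) : G ⧸ H) _ _ (hne y hy) (hne u hu)
      have h2 := fundamentalTensor_comp_linearMap (F ((1 : G) : G ⧸ H))
        ((projDeriv (E' := E') (E := E) H ∘ₗ D.m.subtype) ∘ₗ L.toLinearMap) y u u
      exact h1.trans_eq h2.symm
    obtain ⟨Γ, P, -, hspray⟩ := hDouglas e he x₀ hx₀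
    refine cyclicSum_iff_of_closed hsymm hpos hd hX' hb₀' hψ hψ₁ hψ₂ hnon halt (fun u v => ?_) hcyc'
    rw [hbrB, map_neg, closed_of_spray hsymm hpos hd hX' hb₀' hψpos hψ hψ₁ hnon hf hfpos hB hB0 hFB
      hspray, neg_zero]
  · refine iff_of_true (fun x y z hy => ?_) (fun u v y => ?_)
    · rcases exists_eq_smul_add_smul_of_finrank_le_two hd hy x z with ⟨p, q, h⟩ | ⟨p, q, h⟩
      · exact cyclicSum_eq_zero_of_eq_smul_add_smul hsymm halt h
      · rw [← neg_eq_zero, ← cyclicSum_swap halt]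
        exact cyclicSum_eq_zero_of_eq_smul_add_smul hsymm halt h
    · by_cases hy : y = 0
      · simp [cyclicDefect, hy]
      rcases exists_eq_smul_add_smul_of_finrank_le_two hd hy u v with ⟨p, q, h⟩ | ⟨p, q, h⟩
      · exact cyclicDefect_eq_zero_of_eq_smul_add_smul halt h
      · rw [← neg_eq_zero, ← cyclicDefect_swap]
        exact cyclicDefect_eq_zero_of_eq_smul_add_smul halt h
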